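/- Let $(X,d)$ be a separable metric space with its Borel $\sigma$-algebra, let $\mu$ be a Borel probability measure on $X$, and let $(Y,\mathcal B',\nu)$ be a probability space. Let $F_1=(F_1^s)_{s\in\mathbb R}$ and $F_2=(F_2^s)_{s\in\mathbb R}$ be measurable ergodic measure-preserving flows on $(X,\mu)$ and $(Y,\nu)$: actions of $\mathbb R$ such that $(s,x)\mapsto F_j^s x$ is jointly measurable, each $F_j^s$ preserves the measure, and every measurable set that is invariant modulo null sets under all $F_j^s$ has measure $0$ or $1$. Let $(t_i)_{i\ge 1}$ be a sequence of real numbers and let $c>0$. Assume that $(t_i)$ is a $c$-partial rigidity sequence for $F_1$, i.e. there are measurable sets $S_1,S_2,\dots\subset X$ such that 1. $\mu(S_i)\ge c$ for all $i$, 2. $\lim_{i\to\infty}\int_{S_i} d(F_1^{t_i}x,x)\,d\mu(x)=0$, 3. $\lim_{i\to\infty}\mu(F_1^sS_i\,\triangle\,S_i)=0$ for every $s\in\mathbb R$. Let $U^s f=f\circ F_2^s$ on the complex Hilbert space $L^2(Y,\nu)$. An eigenfunction of $U$ with eigenvalue $e^{is\alpha}$, $\alpha\in\mathbb R$, is a nonzero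 $f\in L^2(Y,\nu)$ with $U^sf=e^{is\alpha}f$ for all $s\in\mathbb R$. Let $\mathcal H_{pp}$ be the closed linear span of all eigenfunctions, and let $\mathcal H_c=\mathcal H_{pp}^{\perp}$ be the continuous-spectrum subspace. Assume that $F_2$ satisfies condition (*) along $(t_i)$, i.e. 1. $\inf_i|e^{it_i\alpha}-1|>0$ for every $\alpha\in\mathbb R$ such that $e^{is\alpha}$ is the eigenvalue of some eigenfunction that is not almost everywhere constant (in the exponent, $i=\sqrt{-1}$), 2. $U^{t_i}f\to 0$ weakly in $L^2(Y,\nu)$ for every $f\in\mathcal H_c$. Then $F_1$ and $F_2$ are disjoint: $\mu\times\nu$ is the only joining, i.e. the only measure on $X\times Y$ that is invariant under $F_1^s\times F_2^s$ for all $s\in\mathbb R$ and has marginals $\mu$ and $\nu$. -/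

import Mathlib

open MeasureTheory Filter Topology

/-! A flow `F` on a measurable space `X` is given as an additive action of `ℝ`, with
`F^s x = s +ᵥ x`; it is measurable when `(s, x) ↦ s +ᵥ x` is (`MeasurableVAdd₂ ℝ X`), it preserves
`μ` when `VAddInvariantMeasure ℝ X μ`, and it is ergodic when `ErgodicVAdd ℝ X μ`. -/

namespace FlowDisjointness

section Koopman

variable {Y : Type*} [MeasurableSpace Y] [AddAction ℝ Y] [MeasurableConstVAdd ℝ Y]
  (ν : Measure Y) [VAddInvariantMeasure ℝ Y ν]

/-- The Koopman operator `U^t f = f ∘ F^t` on complex `L²(ν)`. -/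
noncomputable def koopman (t : ℝ) : Lp ℂ 2 ν →ₗᵢ[ℂ] Lp ℂ 2 ν :=
  Lp.compMeasurePreservingₗᵢ ℂ (fun y : Y => t +ᵥ y) (measurePreserving_vadd t ν)

/-- `U^s f = e^{isα} f` for every `s`: either `f = 0`, or `f` is an eigenfunction of the
one-parameter group `U` with eigenvalue `e^{isα}`. -/
def IsEigenvector (α : ℝ) (f : Lp ℂ 2 ν) : Prop :=
  ∀ s : ℝ, koopman ν s f = Complex.exp (Complex.I * s * α) • f

/-- `e^{isα}` is an eigenvalue of `U` that has a nonconstant eigenfunction. -/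
def IsNonconstantEigenvalue (α : ℝ) : Prop :=
  ∃ f : Lp ℂ 2 ν, IsEigenvector ν α f ∧ ¬ ∃ a : ℂ, f =ᵐ[ν] fun _ => a

/-- `H_pp`: the closed linear span of the eigenfunctions. -/
noncomputable def purePoint : Submodule ℂ (Lp ℂ 2 ν) :=
  (Submodule.span ℂ {f : Lp ℂ 2 ν | ∃ α : ℝ, IsEigenvector ν α f}).topologicalClosure

/-- `H_c`: the continuous-spectrum subspace, the orthogonal complement of `H_pp`. -/
noncomputable def continuousPart : Submodule ℂ (Lp ℂ 2 ν) :=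
  (purePoint ν)ᗮ

/-- Condition (*) along the sequence `t`. -/
structure ConditionStar (t : ℕ → ℝ) : Prop where
  /-- Each nonconstant eigenvalue stays boundedly away from `1` along `t`. -/
  eigenvalue_away : ∀ α : ℝ, IsNonconstantEigenvalue ν α →
    ∃ δ : ℝ, 0 < δ ∧ ∀ i : ℕ, δ ≤ ‖Complex.exp (Complex.I * t i * α) - 1‖
  /-- `U^{t_i} f → 0` weakly in `L²(ν)` for every `f ∈ H_c`. -/
  tendsto_weakly : ∀ f ∈ continuousPart ν, ∀ g : Lp ℂ 2 ν,
    Tendsto (fun i : ℕ => inner ℂ g (koopman ν (t i) f)) atTop (𝓝 0)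

end Koopman

/-- `t` is a `c`-partial rigidity sequence for the flow on the metric space `X`. -/
def IsPartialRigiditySeq {X : Type*} [MetricSpace X] [MeasurableSpace X] [AddAction ℝ X]
    (μ : Measure X) (c : ℝ) (t : ℕ → ℝ) : Prop :=
  ∃ S : ℕ → Set X,
    (∀ i, MeasurableSet (S i)) ∧
    (∀ i, c ≤ μ.real (S i)) ∧
    Tendsto (fun i => ∫⁻ x in S i, edist (t i +ᵥ x) x ∂μ) atTop (𝓝 0) ∧
    ∀ s : ℝ, Tendsto (fun i => μ (symmDiff ((fun x : X => s +ᵥ x) '' S i) (S i))) atTop (𝓝 0)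

section Joinings

variable {X Y : Type*} [MeasurableSpace X] [MeasurableSpace Y] [AddAction ℝ X] [AddAction ℝ Y]
  (μ : Measure X) (ν : Measure Y)

/-- A joining: a measure on `X × Y` with marginals `μ` and `ν` that is invariant under the product
flow `s +ᵥ (x, y) = (s +ᵥ x, s +ᵥ y)`. -/
structure IsJoining (ρ : Measure (X × Y)) : Prop where
  invariant : VAddInvariantMeasure ℝ (X × Y) ρ
  map_fst : ρ.map Prod.fst = μ
  map_snd : ρ.map Prod.snd = ν

/-- The two flows are disjoint: `μ × ν` is their only joining. -/
def AreDisjoint : Prop :=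
  ∀ ρ : Measure (X × Y), IsJoining μ ν ρ ↔ ρ = μ.prod ν

end Joinings

end FlowDisjointness

/-! A joining ρ is encoded by its Markov operator A from L²(μ) to L²(ν), which intertwines the
flows; independence means that A kills functions of zero mean (`markov_eq_zero`).

Ergodicity makes the asymptotically invariant sets S_i asymptotically independent of everything:
1_{S_i} f - μ(S_i) f → 0 weakly. Rigidity makes U^{t_i} close to the identity on S_i
(`tendsto_mulInd_koopman_sub`). Together, for every bounded intertwiner T, ⟨U^{t_i} g, T(1_{S_i} f)⟩
is asymptotic to μ(S_i)⟨g, T f⟩ (`tendsto_inner_koopman_map_mulInd_sub`). Testing against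
eigenfunctions, the first half of (*) shows that T sends zero-mean functions into H_c. If T is also
Hilbert–Schmidt, then T(1_{S_i} f) is close in norm to μ(S_i) T f; with g = T f the second half of
(*) forces μ(S_i)‖g‖² → 0, so T f = 0 because μ(S_i) ≥ c (`map_eq_zero_of_hilbertSchmidt`).

A itself need not be compact. Let W be a weak operator limit of V_i : g ↦ 1_{S_i}(x) g(F_2^{t_i} y),
from L²(ν) to L²(ρ), and put T = W*WA. Positivity of A and mixing on its range give |T f| ≤ ‖f‖
almost everywhere (`norm_inner_weak_limit_le`), and such an operator is Hilbert–Schmidt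
(`sum_norm_sq_le_of_ae_le`). Hence T f = 0 and W A f = 0 for f of zero mean. But ⟨V_i A f, f∘p⟩ =
⟨U^{t_i} A f, A(1_{S_i} f)⟩, with p the projection to X, is asymptotic to μ(S_i)‖A f‖², so A f = 0.
-/

namespace FlowDisjointness

open scoped ENNReal InnerProductSpace

/-! ### Uniformly bounded families of operators -/

section Operators

variable {E F : Type*} [NormedAddCommGroup E] [NormedSpace ℂ E]
  [NormedAddCommGroup F] [NormedSpace ℂ F]

/-- For a uniformly bounded family of operators, convergence to zero is a closed condition. -/
theorem isClosed_setOf_tendsto_zero {ι : Type*} {l : Filter ι} {L : ι → E →L[ℂ] F} {C : ℝ}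
    (hL : ∀ i, ‖L i‖ ≤ C) : IsClosed {x | Tendsto (fun i => L i x) l (𝓝 0)} := by
  refine isClosed_of_closure_subset fun x hx => ?_
  rw [Set.mem_ofPred_eq, Metric.tendsto_nhds]
  intro ε hε
  have hC : 0 < |C| + 1 := by positivity
  obtain ⟨y, hy, hxy⟩ := Metric.mem_closure_iff.1 hx (ε / 2 / (|C| + 1)) (by positivity)
  filter_upwards [Metric.tendsto_nhds.1 hy (ε / 2) (by positivity)] with i hi
  rw [dist_zero_right] at hi ⊢
  have h1 : ‖L i (x - y)‖ ≤ (|C| + 1) * ‖x - y‖ :=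
    (L i).le_of_opNorm_le ((hL i).trans ((le_abs_self C).trans (by linarith))) _
  have h2 : (|C| + 1) * ‖x - y‖ < ε / 2 := by
    rw [← dist_eq_norm, mul_comm]
    exact (lt_div_iff₀ hC).1 hxy
  calc ‖L i x‖ = ‖L i (x - y) + L i y‖ := by rw [← map_add, sub_add_cancel]
    _ ≤ ‖L i (x - y)‖ + ‖L i y‖ := norm_add_le _ _
    _ < ε := by linarith

end Operators

/-! ### Multiplication by indicators on L² -/

section Indicator

variable {Z : Type*} [MeasurableSpace Z] (m : Measure Z)

/-- The product of an `L²` function with the indicator function of a measurable set. -/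
noncomputable def indicatorLp {S : Set Z} (hS : MeasurableSet S) (f : Lp ℂ 2 m) : Lp ℂ 2 m :=
  MemLp.toLp (S.indicator f) ((Lp.memLp f).indicator hS)

theorem coeFn_indicatorLp {S : Set Z} (hS : MeasurableSet S) (f : Lp ℂ 2 m) :
    indicatorLp m hS f =ᵐ[m] S.indicator f := by
  have h : MemLp (S.indicator f) 2 m := (Lp.memLp f).indicator hS
  exact MemLp.coeFn_toLp h

theorem norm_indicatorLp_le {S : Set Z} (hS : MeasurableSet S) (f : Lp ℂ 2 m) :
    ‖indicatorLp m hS f‖ ≤ 1 * ‖f‖ := by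
  rw [one_mul]
  refine Lp.norm_le_norm_of_ae_le ?_
  filter_upwards [coeFn_indicatorLp m hS f] with z hz
  rw [hz]
  exact norm_indicator_le_norm_self _ _

/-- Multiplication by the indicator function of a measurable set on `L²`, as a linear map. -/
noncomputable def mulIndₗ {S : Set Z} (hS : MeasurableSet S) : Lp ℂ 2 m →ₗ[ℂ] Lp ℂ 2 m where
  toFun := indicatorLp m hS
  map_add' f g := by
    refine Lp.ext ?_
    filter_upwards [Lp.coeFn_add f g, Lp.coeFn_add (indicatorLp m hS f) (indicatorLp m hS g),
      coeFn_indicatorLp m hS f, coeFn_indicatorLp m hS g, coeFn_indicatorLp m hS (f + g)]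
      with z h1 h2 h3 h4 h5
    rw [h5, h2, Pi.add_apply, h3, h4]
    by_cases h : z ∈ S <;> simp only [h, Set.indicator_of_mem, not_false_eq_true,
      Set.indicator_of_notMem, h1, Pi.add_apply, add_zero]
  map_smul' c f := by
    refine Lp.ext ?_
    filter_upwards [Lp.coeFn_smul c f, Lp.coeFn_smul c (indicatorLp m hS f),
      coeFn_indicatorLp m hS f, coeFn_indicatorLp m hS (c • f)] with z h1 h2 h3 h4
    rw [h4, RingHom.id_apply, h2, Pi.smul_apply, h3]
    by_cases h : z ∈ S <;> simp only [h, Set.indicator_of_mem, not_false_eq_true,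
      Set.indicator_of_notMem, h1, Pi.smul_apply, smul_zero]

/-- Multiplication by the indicator function of a measurable set on `L²`. -/
noncomputable def mulInd {S : Set Z} (hS : MeasurableSet S) : Lp ℂ 2 m →L[ℂ] Lp ℂ 2 m :=
  (mulIndₗ m hS).mkContinuous 1 (norm_indicatorLp_le m hS)

theorem mulInd_apply {S : Set Z} (hS : MeasurableSet S) (f : Lp ℂ 2 m) :
    mulInd m hS f = indicatorLp m hS f := rfl

variable {m}
variable {S T : Set Z} (hS : MeasurableSet S) (hT : MeasurableSet T)

theorem coeFn_mulInd (f : Lp ℂ 2 m) : mulInd m hS f =ᵐ[m] S.indicator f := by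
  rw [mulInd_apply]
  exact coeFn_indicatorLp m hS f

theorem norm_mulInd_le : ‖mulInd m hS‖ ≤ 1 :=
  LinearMap.mkContinuous_norm_le _ zero_le_one _

theorem norm_mulInd_apply_le (f : Lp ℂ 2 m) : ‖mulInd m hS f‖ ≤ ‖f‖ := by
  simpa using (mulInd m hS).le_of_opNorm_le (norm_mulInd_le hS) f

theorem inner_mulInd_right (f g : Lp ℂ 2 m) : ⟪f, mulInd m hS g⟫_ℂ = ∫ z in S, ⟪f z, g z⟫_ℂ ∂m := by
  rw [L2.inner_def, ← integral_indicator hS]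
  refine integral_congr_ae ?_
  filter_upwards [coeFn_mulInd hS g] with z hz
  rw [hz]
  by_cases h : z ∈ S <;> simp [h]

theorem inner_mulInd_left (f g : Lp ℂ 2 m) : ⟪mulInd m hS f, g⟫_ℂ = ⟪f, mulInd m hS g⟫_ℂ := by
  rw [inner_mulInd_right, L2.inner_def, ← integral_indicator hS]
  refine integral_congr_ae ?_
  filter_upwards [coeFn_mulInd hS f] with z hz
  rw [hz]
  by_cases h : z ∈ S <;> simp [h]

/-- Absolute continuity of the integral of |f|². -/
theorem tendsto_mulInd_zero {ι : Type*} {l : Filter ι} {D : ι → Set Z}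
    (hD : ∀ i, MeasurableSet (D i)) (h : Tendsto (fun i => m (D i)) l (𝓝 0)) (f : Lp ℂ 2 m) :
    Tendsto (fun i => mulInd m (hD i) f) l (𝓝 0) := by
  rw [Metric.tendsto_nhds]
  intro ε hε
  obtain ⟨δ, hδ, H⟩ := (Lp.memLp f).eLpNorm_indicator_le (by norm_num) (by norm_num) (half_pos hε)
  filter_upwards [(ENNReal.tendsto_nhds_zero.1 h) (ENNReal.ofReal δ) (by simpa using hδ)] with i hi
  have h1 := H (D i) (hD i) hi
  rw [dist_zero_right, mulInd_apply, indicatorLp, Lp.norm_toLp]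
  have := ENNReal.toReal_mono (by simp) h1
  rw [ENNReal.toReal_ofReal (by positivity)] at this
  linarith

theorem norm_mulInd_sub_le (f : Lp ℂ 2 m) :
    ‖mulInd m hS f - mulInd m hT f‖ ≤ ‖mulInd m (hS.symmDiff hT) f‖ := by
  refine Lp.norm_le_norm_of_ae_le ?_
  filter_upwards [coeFn_mulInd hS f, coeFn_mulInd hT f, coeFn_mulInd (hS.symmDiff hT) f,
    Lp.coeFn_sub (mulInd m hS f) (mulInd m hT f)] with z h1 h2 h3 h4
  rw [h4, Pi.sub_apply, h1, h2, h3]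
  by_cases hs : z ∈ S <;> by_cases ht : z ∈ T <;> simp [hs, ht, Set.mem_symmDiff]

theorem mulInd_comm (f : Lp ℂ 2 m) :
    mulInd m hS (mulInd m hT f) = mulInd m (hS.inter hT) f := by
  refine Lp.ext ?_
  filter_upwards [coeFn_mulInd hS (mulInd m hT f), coeFn_mulInd hT f,
    coeFn_mulInd (hS.inter hT) f] with z h1 h2 h3
  rw [h1, h3]
  by_cases hs : z ∈ S <;> by_cases ht : z ∈ T <;> simp [hs, ht, h2]

end Indicator

/-! ### Koopman group -/

section Flow

variable {Z : Type*} [MeasurableSpace Z] [AddAction ℝ Z] [MeasurableConstVAdd ℝ Z]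
  {m : Measure Z} [VAddInvariantMeasure ℝ Z m]

theorem coeFn_koopman (s : ℝ) (f : Lp ℂ 2 m) :
    koopman m s f =ᵐ[m] fun z => f (s +ᵥ z) :=
  Lp.coeFn_compMeasurePreserving f (measurePreserving_vadd s m)

theorem koopman_koopman (s t : ℝ) (f : Lp ℂ 2 m) :
    koopman m s (koopman m t f) = koopman m (s + t) f := by
  refine Lp.ext ?_
  have h := (measurePreserving_vadd s m).quasiMeasurePreserving.ae (coeFn_koopman t f)
  filter_upwards [coeFn_koopman s (koopman m t f), coeFn_koopman (s + t) f, h] with z h1 h2 h3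
  rw [h1, h2, h3, vadd_vadd, add_comm]

theorem koopman_zero (f : Lp ℂ 2 m) : koopman m 0 f = f := by
  refine Lp.ext ?_
  filter_upwards [coeFn_koopman 0 f] with z h1
  rw [h1, zero_vadd]

theorem koopman_koopman_neg (s : ℝ) (f : Lp ℂ 2 m) : koopman m s (koopman m (-s) f) = f := by
  rw [koopman_koopman, add_neg_cancel, koopman_zero]

theorem inner_koopman_left (s : ℝ) (f g : Lp ℂ 2 m) :
    ⟪koopman m s f, g⟫_ℂ = ⟪f, koopman m (-s) g⟫_ℂ := by
  rw [← LinearIsometry.inner_map_map (koopman m s) f, koopman_koopman_neg]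

theorem mulInd_koopman (s : ℝ) {S : Set Z} (hS : MeasurableSet S)
    (hS' : MeasurableSet ((fun z : Z => s +ᵥ z) ⁻¹' S)) (f : Lp ℂ 2 m) :
    koopman m s (mulInd m hS f) = mulInd m hS' (koopman m s f) := by
  refine Lp.ext ?_
  have h := (measurePreserving_vadd s m).quasiMeasurePreserving.ae (coeFn_mulInd hS f)
  filter_upwards [coeFn_koopman s (mulInd m hS f), coeFn_mulInd hS' (koopman m s f),
    coeFn_koopman s f, h] with z h1 h2 h3 h4
  rw [h1, h2, h4]
  by_cases hz : s +ᵥ z ∈ S <;> simp [hz, h3]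

end Flow

/-! ### Constants, and density of indicators in L² -/

section Constants

variable {Z : Type*} [MeasurableSpace Z] (m : Measure Z) [IsProbabilityMeasure m]

/-- The constant function `1` in `L²`. -/
noncomputable def oneL2 : Lp ℂ 2 m := indicatorConstLp 2 MeasurableSet.univ (measure_ne_top m _) 1

theorem coeFn_oneL2 : oneL2 m =ᵐ[m] fun _ => 1 := by
  filter_upwards [indicatorConstLp_coeFn (p := 2) (hs := MeasurableSet.univ)
    (hμs := measure_ne_top m _) (c := (1 : ℂ))] with z hz
  rw [oneL2, hz]
  simp

theorem inner_oneL2_left (f : Lp ℂ 2 m) : ⟪oneL2 m, f⟫_ℂ = ∫ z, f z ∂m := by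
  rw [oneL2, L2.inner_indicatorConstLp_one, setIntegral_univ]

theorem norm_oneL2 : ‖oneL2 m‖ = 1 := by
  rw [oneL2, norm_indicatorConstLp (by norm_num) (by norm_num)]
  simp

theorem inner_oneL2_self : ⟪oneL2 m, oneL2 m⟫_ℂ = 1 := by
  rw [inner_self_eq_norm_sq_to_K, norm_oneL2]
  simp

variable {m} in
theorem eq_smul_oneL2_iff (f : Lp ℂ 2 m) (a : ℂ) : f = a • oneL2 m ↔ f =ᵐ[m] fun _ => a := by
  have h : ⇑(a • oneL2 m) =ᵐ[m] fun _ => a := by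
    filter_upwards [Lp.coeFn_smul a (oneL2 m), coeFn_oneL2 m] with z h1 h2
    rw [h1, Pi.smul_apply, h2, smul_eq_mul, mul_one]
  exact ⟨fun hf => hf ▸ h, fun hf => Lp.ext (hf.trans h.symm)⟩

theorem indicatorConstLp_eq_smul_mulInd {B : Set Z} (hB : MeasurableSet B) (c : ℂ) :
    indicatorConstLp 2 hB (measure_ne_top m _) c = c • mulInd m hB (oneL2 m) := by
  refine Lp.ext ?_
  filter_upwards [indicatorConstLp_coeFn (p := 2) (hs := hB) (hμs := measure_ne_top m _) (c := c),
    Lp.coeFn_smul c (mulInd m hB (oneL2 m)), coeFn_mulInd hB (oneL2 m), coeFn_oneL2 m]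
    with z h1 h2 h3 h4
  rw [h1, h2, Pi.smul_apply, h3]
  by_cases hz : z ∈ B <;> simp [hz, h4]

/-- A closed set of `L²` functions which is stable under sums and scalar multiples and contains
the indicator functions is everything. -/
theorem Lp_induction_of_isClosed {P : Lp ℂ 2 m → Prop} (hc : IsClosed {f | P f})
    (hadd : ∀ f g, P f → P g → P (f + g)) (hsmul : ∀ (c : ℂ) f, P f → P (c • f))
    (hind : ∀ (B : Set Z) (hB : MeasurableSet B), P (mulInd m hB (oneL2 m))) (f : Lp ℂ 2 m) :
    P f := by
  refine Lp.induction (by norm_num) P (fun c B hB hμB => ?_)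
    (fun _ _ _ _ _ h1 h2 => hadd _ _ h1 h2) hc f
  rw [Lp.simpleFunc.coe_indicatorConst, indicatorConstLp_eq_smul_mulInd]
  exact hsmul _ _ (hind _ hB)

theorem tendsto_zero_of_forall_mulInd {F : Type*} [NormedAddCommGroup F] [NormedSpace ℂ F]
    {ι : Type*} {l : Filter ι} {L : ι → Lp ℂ 2 m →L[ℂ] F} {C : ℝ} (hL : ∀ i, ‖L i‖ ≤ C)
    (h : ∀ (B : Set Z) (hB : MeasurableSet B),
      Tendsto (fun i => L i (mulInd m hB (oneL2 m))) l (𝓝 0)) (f : Lp ℂ 2 m) :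
    Tendsto (fun i => L i f) l (𝓝 0) := by
  refine Lp_induction_of_isClosed m (P := fun f => Tendsto (fun i => L i f) l (𝓝 0))
    (isClosed_setOf_tendsto_zero hL) ?_ ?_ h f
  · intro f g hf hg
    simpa using hf.add hg
  · intro c f hf
    simpa using hf.const_smul c

theorem inner_mulInd_oneL2 {S : Set Z} (hS : MeasurableSet S) :
    ⟪oneL2 m, mulInd m hS (oneL2 m)⟫_ℂ = m.real S := by
  have h : mulInd m hS (oneL2 m) = indicatorConstLp 2 hS (measure_ne_top m _) 1 := by
    rw [indicatorConstLp_eq_smul_mulInd, one_smul]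
  rw [h, inner_oneL2_left, integral_indicatorConstLp]
  simp

end Constants

/-! ### Ergodicity and asymptotically invariant sets -/

section Ergodic

variable {Z : Type*} [MeasurableSpace Z] [AddAction ℝ Z] [MeasurableConstVAdd ℝ Z]
  {m : Measure Z}

theorem koopman_oneL2 [IsProbabilityMeasure m] [VAddInvariantMeasure ℝ Z m] (s : ℝ) :
    koopman m s (oneL2 m) = oneL2 m := by
  refine Lp.ext ?_
  have h := (measurePreserving_vadd s m).quasiMeasurePreserving.ae (coeFn_oneL2 m)
  filter_upwards [coeFn_koopman s (oneL2 m), coeFn_oneL2 m, h] with z h1 h2 h3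
  rw [h1, h2, h3]

/-- Preimages of measurable sets are invariant modulo null sets, hence null or conull; since
countably many measurable sets separate the points of ℂ, this pins down one value. -/
theorem ae_const_of_koopman_eq [ErgodicVAdd ℝ Z m] {f : Lp ℂ 2 m}
    (h : ∀ s : ℝ, koopman m s f = f) : ∃ a : ℂ, f =ᵐ[m] fun _ => a := by
  refine exists_eventuallyEq_const_of_forall_separating MeasurableSet fun U hU => ?_
  have hconst : EventuallyConst (f ⁻¹' U) (ae m) := by
    refine aeconst_of_forall_preimage_vadd_ae_eq ℝ
      ((Lp.stronglyMeasurable f).measurable hU).nullMeasurableSet fun s => ?_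
    have h1 := coeFn_koopman s f
    rw [h s] at h1
    refine (h1.mono fun z hz => ?_).set_eq
    rw [Set.mem_preimage, Set.mem_preimage, Set.mem_preimage, hz]
  exact eventuallyConst_set.1 hconst

variable [IsProbabilityMeasure m]

/-- The orthogonal complement of the coboundaries consists of invariant functions, which are
constants by ergodicity; take orthogonal complements once more. -/
theorem mem_closure_coboundaries [ErgodicVAdd ℝ Z m] {f : Lp ℂ 2 m} (hf : ⟪oneL2 m, f⟫_ℂ = 0) :
    f ∈ (Submodule.span ℂ {g : Lp ℂ 2 m | ∃ (s : ℝ) (z : Lp ℂ 2 m),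
      g = koopman m s z - z}).topologicalClosure := by
  rw [← Submodule.orthogonal_orthogonal_eq_closure, Submodule.mem_orthogonal]
  intro v hv
  have hinv : ∀ s : ℝ, koopman m s v = v := by
    intro s
    refine ext_inner_left ℂ fun z => ?_
    have h1 := (Submodule.mem_orthogonal _ _).1 hv (koopman m (-s) z - z)
      (Submodule.subset_span ⟨_, _, rfl⟩)
    rw [inner_sub_left, inner_koopman_left, neg_neg, sub_eq_zero] at h1
    exact h1
  obtain ⟨a, ha⟩ := ae_const_of_koopman_eq hinv
  rw [(eq_smul_oneL2_iff v a).2 ha, inner_smul_left, hf, mul_zero]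

/-- A bounded family of functionals which vanishes asymptotically on coboundaries vanishes
asymptotically on functions of zero mean. -/
theorem tendsto_zero_of_coboundaries [ErgodicVAdd ℝ Z m] {F : Type*} [NormedAddCommGroup F]
    [NormedSpace ℂ F] {ι : Type*} {l : Filter ι} {L : ι → Lp ℂ 2 m →L[ℂ] F} {C : ℝ}
    (hL : ∀ i, ‖L i‖ ≤ C)
    (h : ∀ (s : ℝ) (z : Lp ℂ 2 m), Tendsto (fun i => L i (koopman m s z - z)) l (𝓝 0))
    {f : Lp ℂ 2 m} (hf : ⟪oneL2 m, f⟫_ℂ = 0) : Tendsto (fun i => L i f) l (𝓝 0) := by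
  have hc := isClosed_setOf_tendsto_zero (l := l) hL
  have hmem := mem_closure_coboundaries hf
  rw [← SetLike.mem_coe, Submodule.topologicalClosure_coe] at hmem
  refine (closure_minimal ?_ hc) hmem
  intro g hg
  induction hg using Submodule.span_induction with
  | mem x hx =>
    obtain ⟨s, z, rfl⟩ := hx
    exact h s z
  | zero => simpa using tendsto_const_nhds
  | add x y _ _ hx hy => simpa using Filter.Tendsto.add hx hy
  | smul c x _ hx => simpa using Filter.Tendsto.const_smul hx c

variable [ErgodicVAdd ℝ Z m] {S : ℕ → Set Z} (hS : ∀ i, MeasurableSet (S i))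
  (hinv : ∀ s : ℝ, Tendsto (fun i => m (symmDiff ((fun z : Z => s +ᵥ z) ⁻¹' S i) (S i)))
    atTop (𝓝 0))
include hinv

/-- Asymptotically invariant sets are asymptotically independent of everything. -/
theorem tendsto_inner_mulInd_oneL2 {f : Lp ℂ 2 m} (hf : ⟪oneL2 m, f⟫_ℂ = 0) :
    Tendsto (fun i => ⟪mulInd m (hS i) (oneL2 m), f⟫_ℂ) atTop (𝓝 0) := by
  refine tendsto_zero_of_coboundaries
    (L := fun i => innerSL ℂ (mulInd m (hS i) (oneL2 m))) (C := 1) ?_ ?_ hf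
  · intro i
    rw [innerSL_apply_norm]
    exact (norm_mulInd_apply_le _ _).trans_eq (norm_oneL2 m)
  · intro s z
    have hS' : ∀ i, MeasurableSet ((fun z : Z => -s +ᵥ z) ⁻¹' S i) := fun i =>
      measurable_const_vadd (-s) (hS i)
    have key : ∀ i, ⟪mulInd m (hS i) (oneL2 m), koopman m s z - z⟫_ℂ =
        ⟪mulInd m (hS' i) (oneL2 m) - mulInd m (hS i) (oneL2 m), z⟫_ℂ := by
      intro i
      rw [inner_sub_right, inner_sub_left, ← koopman_oneL2 (m := m) (-s),
        ← mulInd_koopman (-s) (hS i), inner_koopman_left, neg_neg, koopman_oneL2]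
    simp only [innerSL_apply_apply, key]
    rw [tendsto_zero_iff_norm_tendsto_zero]
    have h1 := (tendsto_mulInd_zero (fun i => (hS' i).symmDiff (hS i)) (hinv (-s)) (oneL2 m)).norm
    have h2 := h1.mul_const ‖z‖
    rw [norm_zero, zero_mul] at h2
    refine squeeze_zero (fun _ => norm_nonneg _) (fun i => ?_) h2
    exact (norm_inner_le_norm _ _).trans
      (mul_le_mul_of_nonneg_right (norm_mulInd_sub_le _ _ _) (norm_nonneg _))

/-- `1_{S_i} - m(S_i)` tends to zero in the weak operator topology. -/
theorem tendsto_inner_mulInd_sub (f z : Lp ℂ 2 m) :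
    Tendsto (fun i => ⟪z, mulInd m (hS i) f - (m.real (S i) : ℂ) • f⟫_ℂ) atTop (𝓝 0) := by
  let D : ℕ → Lp ℂ 2 m →L[ℂ] Lp ℂ 2 m := fun i =>
    mulInd m (hS i) - (m.real (S i) : ℂ) • ContinuousLinearMap.id ℂ _
  have hone : ∀ z : Lp ℂ 2 m, Tendsto (fun i => ⟪z, D i (oneL2 m)⟫_ℂ) atTop (𝓝 0) := by
    intro z
    have h1 := tendsto_inner_mulInd_oneL2 hS hinv (f := z - ⟪oneL2 m, z⟫_ℂ • oneL2 m) (by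
      rw [inner_sub_right, inner_smul_right, inner_oneL2_self, mul_one, sub_self])
    have h2 := (Complex.continuous_conj.tendsto 0).comp h1
    rw [map_zero] at h2
    refine h2.congr fun i => ?_
    have e := inner_mulInd_oneL2 m (hS i)
    simp only [Function.comp, D, sub_apply, smul_apply, ContinuousLinearMap.id_apply,
      inner_sub_right, inner_smul_right, map_sub, map_mul, inner_conj_symm, e]
    ring
  have hD : ∀ i, ‖(innerSL ℂ z).comp (D i)‖ ≤ ‖z‖ * 2 := by
    intro i
    refine (ContinuousLinearMap.opNorm_comp_le _ _).trans ?_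
    rw [innerSL_apply_norm]
    refine mul_le_mul_of_nonneg_left ?_ (norm_nonneg _)
    refine (norm_sub_le _ _).trans ?_
    have h1 : ‖(m.real (S i) : ℂ) • ContinuousLinearMap.id ℂ (Lp ℂ 2 m)‖ ≤ 1 := by
      refine ContinuousLinearMap.opNorm_le_bound _ zero_le_one fun f => ?_
      rw [smul_apply, ContinuousLinearMap.id_apply, norm_smul, Complex.norm_real,
        Real.norm_of_nonneg measureReal_nonneg]
      exact mul_le_mul_of_nonneg_right measureReal_le_one (norm_nonneg _)
    linarith [norm_mulInd_le (m := m) (hS i)]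
  refine tendsto_zero_of_forall_mulInd m hD (fun B hB => ?_) f
  -- Multiplication operators commute and are self-adjoint, so 1_B moves onto the test vector and
  -- only the constant function remains to be treated.
  refine (hone (mulInd m hB z)).congr fun i => ?_
  simp only [ContinuousLinearMap.comp_apply, innerSL_apply_apply, D, inner_mulInd_left,
    sub_apply, smul_apply, ContinuousLinearMap.id_apply,
    map_sub, map_smul, mulInd_comm, Set.inter_comm B, inner_sub_right, inner_smul_right,
    smul_eq_mul]

end Ergodic

/-! ### Partial rigidity in L² -/

section Rigidity

variable {X : Type*} [MetricSpace X] [SecondCountableTopology X] [MeasurableSpace X]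
  [BorelSpace X] [AddAction ℝ X] [MeasurableConstVAdd ℝ X] {μ : Measure X}
  [IsProbabilityMeasure μ] [VAddInvariantMeasure ℝ X μ] {S : ℕ → Set X} {t : ℕ → ℝ}

theorem measurable_edist_vadd (s : ℝ) : Measurable fun x : X => edist (s +ᵥ x) x :=
  (measurable_const_vadd s).edist measurable_id

/-- A point moved by less than δ across the boundary of U starts or lands in the collar R of points
of U at distance less than δ from the complement. The collar is small since the complement is
closed, and so is its preimage by invariance; points of S_i moved by at least δ are few by Markov's
inequality. -/
theorem tendsto_measure_inter_symmDiff_of_isOpen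
    (hS : ∀ i, MeasurableSet (S i))
    (h : Tendsto (fun i => ∫⁻ x in S i, edist (t i +ᵥ x) x ∂μ) atTop (𝓝 0))
    {U : Set X} (hU : IsOpen U) :
    Tendsto (fun i => μ (S i ∩ symmDiff ((fun x : X => t i +ᵥ x) ⁻¹' U) U)) atTop (𝓝 0) := by
  rw [ENNReal.tendsto_nhds_zero]
  intro ε hε
  have h3 : (0 : ℝ≥0∞) < ε / 3 := ENNReal.div_pos hε.ne' (by norm_num)
  have hth := tendsto_measure_thickening_of_isClosed (μ := μ) (s := Uᶜ)
    ⟨1, one_pos, measure_ne_top _ _⟩ hU.isClosed_compl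
  have hlt : μ Uᶜ < μ Uᶜ + ε / 3 := ENNReal.lt_add_right (measure_ne_top _ _) h3.ne'
  obtain ⟨δ, hδlt, hδ⟩ := ((hth.eventually (gt_mem_nhds hlt)).and self_mem_nhdsWithin).exists
  have hδ0 : (0 : ℝ) < δ := hδ
  set R := Metric.thickening δ Uᶜ \ Uᶜ with hR
  have hRm : MeasurableSet R :=
    Metric.isOpen_thickening.measurableSet.diff hU.measurableSet.compl
  have hRle : μ R ≤ ε / 3 := by
    rw [hR, measure_sdiff (Metric.self_subset_thickening hδ0 _)
      hU.measurableSet.compl.nullMeasurableSet (measure_ne_top _ _)]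
    exact tsub_le_iff_left.2 hδlt.le
  have hε3 : (0 : ℝ≥0∞) < ε / 3 * ENNReal.ofReal δ :=
    ENNReal.mul_pos h3.ne' (by simpa using hδ0)
  filter_upwards [(ENNReal.tendsto_nhds_zero.1 h) _ hε3] with i hi
  set Q := S i ∩ {x | ENNReal.ofReal δ ≤ edist (t i +ᵥ x) x}
  have hQle : μ Q ≤ ε / 3 := by
    have h1 := meas_ge_le_lintegral_div (μ := μ.restrict (S i))
      (measurable_edist_vadd (t i)).aemeasurable (ε := ENNReal.ofReal δ) (by simpa using hδ0)
      ENNReal.ofReal_ne_top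
    rw [Measure.restrict_apply' (hS i), Set.inter_comm] at h1
    refine h1.trans (ENNReal.div_le_of_le_mul hi)
  have hR' : μ ((fun x : X => t i +ᵥ x) ⁻¹' R) ≤ ε / 3 := by
    rw [(measurePreserving_vadd (t i) μ).measure_preimage hRm.nullMeasurableSet]
    exact hRle
  have hsub : S i ∩ symmDiff ((fun x : X => t i +ᵥ x) ⁻¹' U) U ⊆
      R ∪ (fun x : X => t i +ᵥ x) ⁻¹' R ∪ Q := by
    rintro x ⟨hxS, hx⟩
    by_cases hd : ENNReal.ofReal δ ≤ edist (t i +ᵥ x) x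
    · exact Or.inr ⟨hxS, hd⟩
    · rw [not_le] at hd
      left
      rcases hx with ⟨h1, h2⟩ | ⟨h1, h2⟩
      · right
        refine ⟨(Metric.mem_thickening_iff_exists_edist_lt _ _).2 ⟨x, h2, hd⟩, ?_⟩
        simpa using h1
      · left
        refine ⟨(Metric.mem_thickening_iff_exists_edist_lt _ _).2 ⟨t i +ᵥ x, h2, ?_⟩, ?_⟩
        · rwa [edist_comm]
        · simpa using h1
  calc μ (S i ∩ symmDiff ((fun x : X => t i +ᵥ x) ⁻¹' U) U)
      ≤ μ R + μ ((fun x : X => t i +ᵥ x) ⁻¹' R) + μ Q :=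
        (measure_mono hsub).trans ((measure_union_le _ _).trans
          (add_le_add_left (measure_union_le _ _) _))
    _ ≤ ε / 3 + ε / 3 + ε / 3 := by gcongr
    _ = ε := ENNReal.add_thirds ε

/-- Outer regularity reduces to an open U ⊇ B: the error lies in U \ B and its preimage, which have
equal measure. -/
theorem tendsto_measure_inter_symmDiff
    (hS : ∀ i, MeasurableSet (S i))
    (h : Tendsto (fun i => ∫⁻ x in S i, edist (t i +ᵥ x) x ∂μ) atTop (𝓝 0))
    {B : Set X} (hB : MeasurableSet B) :
    Tendsto (fun i => μ (S i ∩ symmDiff ((fun x : X => t i +ᵥ x) ⁻¹' B) B)) atTop (𝓝 0) := by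
  rw [ENNReal.tendsto_nhds_zero]
  intro ε hε
  have h3 : (0 : ℝ≥0∞) < ε / 3 := ENNReal.div_pos hε.ne' (by norm_num)
  obtain ⟨U, hBU, hU, -, hUB⟩ := hB.exists_isOpen_sdiff_lt (measure_ne_top μ B) h3.ne'
  have hm : MeasurableSet (U \ B) := hU.measurableSet.diff hB
  filter_upwards [(ENNReal.tendsto_nhds_zero.1
    (tendsto_measure_inter_symmDiff_of_isOpen hS h hU)) _ h3] with i hi
  have h' : μ ((fun x : X => t i +ᵥ x) ⁻¹' (U \ B)) ≤ ε / 3 := by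
    rw [(measurePreserving_vadd (t i) μ).measure_preimage hm.nullMeasurableSet]
    exact hUB.le
  have hsub : S i ∩ symmDiff ((fun x : X => t i +ᵥ x) ⁻¹' B) B ⊆
      (U \ B) ∪ (fun x : X => t i +ᵥ x) ⁻¹' (U \ B) ∪
        (S i ∩ symmDiff ((fun x : X => t i +ᵥ x) ⁻¹' U) U) := by
    rintro x ⟨hxS, hx⟩
    have e1 : x ∈ B → x ∈ U := fun h => hBU h
    have e2 : t i +ᵥ x ∈ B → t i +ᵥ x ∈ U := fun h => hBU h
    simp only [Set.mem_union, Set.mem_inter_iff, Set.mem_symmDiff, Set.mem_preimage,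
      Set.mem_sdiff] at hx ⊢
    tauto
  calc μ (S i ∩ symmDiff ((fun x : X => t i +ᵥ x) ⁻¹' B) B)
      ≤ μ (U \ B) + μ ((fun x : X => t i +ᵥ x) ⁻¹' (U \ B)) +
          μ (S i ∩ symmDiff ((fun x : X => t i +ᵥ x) ⁻¹' U) U) :=
        (measure_mono hsub).trans ((measure_union_le _ _).trans
          (add_le_add_left (measure_union_le _ _) _))
    _ ≤ ε / 3 + ε / 3 + ε / 3 := by gcongr
    _ = ε := ENNReal.add_thirds ε

/-- Along a partial rigidity sequence, `U^{t_i}` is asymptotically the identity on `S_i`. -/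
theorem tendsto_mulInd_koopman_sub (hS : ∀ i, MeasurableSet (S i))
    (h : Tendsto (fun i => ∫⁻ x in S i, edist (t i +ᵥ x) x ∂μ) atTop (𝓝 0)) (f : Lp ℂ 2 μ) :
    Tendsto (fun i => mulInd μ (hS i) (koopman μ (t i) f - f)) atTop (𝓝 0) := by
  let L : ℕ → Lp ℂ 2 μ →L[ℂ] Lp ℂ 2 μ := fun i =>
    (mulInd μ (hS i)).comp
      ((koopman μ (t i)).toContinuousLinearMap - ContinuousLinearMap.id ℂ _)
  have hL : ∀ i, ‖L i‖ ≤ 2 := by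
    intro i
    refine ContinuousLinearMap.opNorm_le_bound _ (by norm_num) fun f => ?_
    have h1 := norm_sub_le (koopman μ (t i) f) f
    rw [LinearIsometry.norm_map, ← two_mul] at h1
    exact (norm_mulInd_apply_le (hS i) (koopman μ (t i) f - f)).trans h1
  refine tendsto_zero_of_forall_mulInd μ hL (fun B hB => ?_) f
  have hB' : ∀ i, MeasurableSet ((fun x : X => t i +ᵥ x) ⁻¹' B) := fun i =>
    measurable_const_vadd (t i) hB
  have hD := tendsto_measure_inter_symmDiff hS h hB
  have hz := (tendsto_mulInd_zero
    (fun i => ((hS i).inter (hB' i)).symmDiff ((hS i).inter hB)) (by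
      simpa only [← Set.inter_symmDiff_distrib_left] using hD) (oneL2 μ)).norm
  rw [norm_zero] at hz
  rw [tendsto_zero_iff_norm_tendsto_zero]
  refine squeeze_zero (fun _ => norm_nonneg _) (fun i => ?_) hz
  have e : L i (mulInd μ hB (oneL2 μ)) =
      mulInd μ ((hS i).inter (hB' i)) (oneL2 μ) - mulInd μ ((hS i).inter hB) (oneL2 μ) := by
    simp only [L, ContinuousLinearMap.comp_apply, sub_apply,
      LinearIsometry.coe_toContinuousLinearMap, ContinuousLinearMap.id_apply, map_sub]
    rw [mulInd_koopman (t i) hB (hB' i), koopman_oneL2, mulInd_comm, mulInd_comm]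
  rw [e]
  exact norm_mulInd_sub_le _ _ _

end Rigidity

/-! ### Hilbert–Schmidt operators, via finite orthonormal families -/

section HilbertSchmidt

variable {E F : Type*} [NormedAddCommGroup E] [InnerProductSpace ℂ E]
  [NormedAddCommGroup F] [InnerProductSpace ℂ F]

/-- A Hilbert–Schmidt operator is small on the orthogonal complement of some finite orthonormal
family. -/
theorem exists_orthonormal_norm_sq_le {T : E →L[ℂ] F} {C : ℝ}
    (hT : ∀ (n : ℕ) (e : Fin n → E), Orthonormal ℂ e → ∑ k, ‖T (e k)‖ ^ 2 ≤ C)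
    {ε : ℝ} (hε : 0 < ε) : ∃ (n : ℕ) (e : Fin n → E), Orthonormal ℂ e ∧
      ∀ v : E, (∀ k, ⟪e k, v⟫_ℂ = 0) → ‖T v‖ ^ 2 ≤ ε * ‖v‖ ^ 2 := by
  let A : Set ℝ := {r | ∃ (n : ℕ) (e : Fin n → E), Orthonormal ℂ e ∧ r = ∑ k, ‖T (e k)‖ ^ 2}
  have hA : BddAbove A := ⟨C, by rintro r ⟨n, e, he, rfl⟩; exact hT n e he⟩
  have hne : A.Nonempty :=
    ⟨0, 0, fun k => k.elim0, ⟨fun k => k.elim0, fun k => k.elim0⟩, by simp⟩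
  -- This family is within ε of the supremum, so adjoining a unit vector orthogonal to it can add at
  -- most ε.
  obtain ⟨r, ⟨n, e, he, rfl⟩, hr⟩ := exists_lt_of_lt_csSup hne (sub_lt_self (sSup A) hε)
  refine ⟨n, e, he, fun v hv => ?_⟩
  by_cases hv0 : v = 0
  · simp [hv0]
  have hn : 0 < ‖v‖ := norm_pos_iff.2 hv0
  set w : E := ((‖v‖⁻¹ : ℝ) : ℂ) • v with hw
  have hw1 : ‖w‖ = 1 := by
    rw [hw, norm_smul, Complex.norm_real, Real.norm_of_nonneg (by positivity),
      inv_mul_cancel₀ hn.ne']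
  have ho : Orthonormal ℂ (Matrix.vecCons w e) := by
    refine orthonormal_vecCons_iff.2 ⟨hw1, fun k => ?_, he⟩
    rw [← inner_conj_symm, hw, inner_smul_right, hv k, mul_zero, map_zero]
  have h1 : ∑ k, ‖T (Matrix.vecCons w e k)‖ ^ 2 ≤ sSup A := le_csSup hA ⟨_, _, ho, rfl⟩
  rw [Fin.sum_univ_succ] at h1
  simp only [Matrix.cons_val_zero, Matrix.cons_val_succ] at h1
  have h2 : ‖T w‖ ^ 2 ≤ ε := by linarith
  have h3 : ‖T v‖ = ‖v‖ * ‖T w‖ := by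
    rw [hw, map_smul, norm_smul, Complex.norm_real, Real.norm_of_nonneg (by positivity),
      mul_inv_cancel_left₀ hn.ne']
  rw [h3, mul_pow, mul_comm]
  exact mul_le_mul_of_nonneg_right h2 (by positivity)

/-- A Hilbert–Schmidt operator maps bounded weak null sequences to norm null sequences. -/
theorem tendsto_map_zero_of_hilbertSchmidt {T : E →L[ℂ] F} {C : ℝ}
    (hT : ∀ (n : ℕ) (e : Fin n → E), Orthonormal ℂ e → ∑ k, ‖T (e k)‖ ^ 2 ≤ C)
    {ι : Type*} {l : Filter ι} {u : ι → E} {M : ℝ} (hM : ∀ i, ‖u i‖ ≤ M)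
    (hu : ∀ z : E, Tendsto (fun i => ⟪z, u i⟫_ℂ) l (𝓝 0)) :
    Tendsto (fun i => T (u i)) l (𝓝 0) := by
  rw [Metric.tendsto_nhds]
  intro δ hδ
  have hM' : 0 < |M| + 1 := by positivity
  -- The remainder u_i - p_i has norm at most |M| + 1 once ‖p_i‖ < 1, so T maps it to norm at most
  -- δ/2.
  set η : ℝ := δ / 2 / (|M| + 1) with hη
  have hη0 : 0 < η := by positivity
  obtain ⟨n, e, he, H⟩ := exists_orthonormal_norm_sq_le hT (ε := η ^ 2) (by positivity)
  set p : ι → E := fun i => ∑ k, ⟪e k, u i⟫_ℂ • e k with hp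
  have hp0 : Tendsto p l (𝓝 0) := by
    have h1 : Tendsto p l (𝓝 (∑ k, (0 : ℂ) • e k)) :=
      tendsto_finsetSum _ fun k _ => (hu (e k)).smul_const (e k)
    simpa using h1
  have hTp : Tendsto (fun i => T (p i)) l (𝓝 0) := by
    have h1 := (T.continuous.tendsto 0).comp hp0
    rw [map_zero] at h1
    exact h1
  filter_upwards [Metric.tendsto_nhds.1 hp0 1 one_pos,
    Metric.tendsto_nhds.1 hTp (δ / 2) (by positivity)] with i h1 h2
  rw [dist_zero_right] at *
  have hv : ∀ k, ⟪e k, u i - p i⟫_ℂ = 0 := by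
    intro k
    rw [inner_sub_right, hp, he.inner_right_fintype, sub_self]
  have h3 : ‖T (u i - p i)‖ ≤ η * ‖u i - p i‖ := by
    refine le_of_sq_le_sq ?_ (by positivity)
    rw [mul_pow]
    exact H _ hv
  have h4 : ‖u i - p i‖ ≤ |M| + 1 :=
    (norm_sub_le _ _).trans (add_le_add ((hM i).trans (le_abs_self M)) h1.le)
  have h5 : η * ‖u i - p i‖ ≤ δ / 2 := by
    calc η * ‖u i - p i‖ ≤ η * (|M| + 1) := mul_le_mul_of_nonneg_left h4 hη0.le
      _ = δ / 2 := by rw [hη]; field_simp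
  calc ‖T (u i)‖ = ‖T (u i - p i) + T (p i)‖ := by rw [← map_add, sub_add_cancel]
    _ ≤ ‖T (u i - p i)‖ + ‖T (p i)‖ := norm_add_le _ _
    _ < δ := by linarith

end HilbertSchmidt

/-! ### Operators bounded into L^∞ are Hilbert–Schmidt -/

section Bounded

variable {Y : Type*} [MeasurableSpace Y] {ν : Measure Y}

theorem integrable_norm_sq (f : Lp ℂ 2 ν) : Integrable (fun y => ‖f y‖ ^ 2) ν :=
  (memLp_two_iff_integrable_sq_norm (Lp.aestronglyMeasurable f)).1 (Lp.memLp f)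

theorem norm_sq_eq_integral (f : Lp ℂ 2 ν) : ‖f‖ ^ 2 = ∫ y, ‖f y‖ ^ 2 ∂ν := by
  have h : ((‖f‖ ^ 2 : ℝ) : ℂ) = ((∫ y, ‖f y‖ ^ 2 ∂ν : ℝ) : ℂ) := by
    rw [← integral_complex_ofReal, Complex.ofReal_pow]
    refine (inner_self_eq_norm_sq_to_K (𝕜 := ℂ) f).symm.trans ?_
    rw [L2.inner_def]
    refine integral_congr_ae (Eventually.of_forall fun y => ?_)
    simp [inner_self_eq_norm_sq_to_K]
  exact_mod_cast h

/-- An operator from a Hilbert space to `L²` of a probability space which is bounded as an operator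
into `L^∞` is Hilbert–Schmidt. -/
theorem sum_norm_sq_le_of_ae_le [IsProbabilityMeasure ν] {E : Type*} [NormedAddCommGroup E]
    [InnerProductSpace ℂ E] {T : E →L[ℂ] Lp ℂ 2 ν} (hT : ∀ f : E, ∀ᵐ y ∂ν, ‖T f y‖ ≤ ‖f‖)
    (n : ℕ) (e : Fin n → E) (he : Orthonormal ℂ e) : ∑ k, ‖T (e k)‖ ^ 2 ≤ 1 := by
  have hcoe : ∀ c : EuclideanSpace ℂ (Fin n),
      ∀ᵐ y ∂ν, (T (∑ k, c k • e k)) y = ∑ k, c k * T (e k) y := by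
    intro c
    have h1 : T (∑ k, c k • e k) = ∑ k, c k • T (e k) := by simp
    rw [h1]
    have h3 : ∀ᵐ y ∂ν, ∀ k, (c k • T (e k) : Lp ℂ 2 ν) y = c k * T (e k) y := by
      refine ae_all_iff.2 fun k => ?_
      filter_upwards [Lp.coeFn_smul (c k) (T (e k))] with y hy
      rw [hy, Pi.smul_apply, smul_eq_mul]
    filter_upwards [Lp.coeFn_finsetSum Finset.univ (fun k => c k • T (e k)), h3] with y h2 h3
    rw [h2, Finset.sum_apply]
    exact Finset.sum_congr rfl fun k _ => h3 k
  have hbound : ∀ c : EuclideanSpace ℂ (Fin n), ‖∑ k, c k • e k‖ = ‖c‖ := by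
    intro c
    rw [EuclideanSpace.norm_eq, ← Real.sqrt_sq (norm_nonneg (∑ k, c k • e k))]
    congr 1
    have h1 := he.inner_sum c c Finset.univ
    rw [inner_self_eq_norm_sq_to_K] at h1
    have h2 : ((‖∑ k, c k • e k‖ ^ 2 : ℝ) : ℂ) = ((∑ k, ‖c k‖ ^ 2 : ℝ) : ℂ) := by
      push_cast
      refine h1.trans (Finset.sum_congr rfl fun k _ => ?_)
      rw [Complex.conj_mul']
    exact_mod_cast h2
  -- The exceptional null set must not depend on c: use a countable dense set of coefficient
  -- vectors, then continuity.
  have hae : ∀ᵐ y ∂ν, ∀ c : EuclideanSpace ℂ (Fin n), ‖∑ k, c k * T (e k) y‖ ≤ ‖c‖ := by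
    have h1 : ∀ᵐ y ∂ν, ∀ j : ℕ, ‖∑ k, (TopologicalSpace.denseSeq
        (EuclideanSpace ℂ (Fin n)) j) k * T (e k) y‖ ≤ ‖TopologicalSpace.denseSeq
        (EuclideanSpace ℂ (Fin n)) j‖ := by
      refine ae_all_iff.2 fun j => ?_
      filter_upwards [hcoe (TopologicalSpace.denseSeq _ j),
        hT (∑ k, (TopologicalSpace.denseSeq (EuclideanSpace ℂ (Fin n)) j) k • e k)] with y h2 h3
      rwa [← h2, ← hbound]
    filter_upwards [h1] with y hy c
    have hcl : IsClosed {c : EuclideanSpace ℂ (Fin n) | ‖∑ k, c k * T (e k) y‖ ≤ ‖c‖} :=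
      isClosed_le (by fun_prop) (by fun_prop)
    have hd := (TopologicalSpace.denseRange_denseSeq (EuclideanSpace ℂ (Fin n)))
    exact (closure_minimal (by rintro _ ⟨j, rfl⟩; exact hy j) hcl) (hd c)
  have hpt : ∀ᵐ y ∂ν, ∑ k, ‖T (e k) y‖ ^ 2 ≤ 1 := by
    filter_upwards [hae] with y hy
    -- For this choice of c the bound reads s ≤ √s, where s = ∑ |T(e_k)(y)|², hence s ≤ 1.
    have h1 := hy (WithLp.toLp 2 fun k => starRingEnd ℂ (T (e k) y))
    have h2 : ∑ k, (WithLp.toLp 2 fun k => starRingEnd ℂ (T (e k) y) : EuclideanSpace ℂ (Fin n)) k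
        * T (e k) y = ((∑ k, ‖T (e k) y‖ ^ 2 : ℝ) : ℂ) := by
      push_cast
      exact Finset.sum_congr rfl fun k _ => Complex.conj_mul' _
    have h0 : 0 ≤ ∑ k, ‖T (e k) y‖ ^ 2 := Finset.sum_nonneg fun _ _ => by positivity
    rw [h2, Complex.norm_real, Real.norm_of_nonneg h0, EuclideanSpace.norm_eq] at h1
    simp only [RCLike.norm_conj] at h1
    have h3 := Real.sq_sqrt h0
    have h4 := Real.sqrt_nonneg (∑ k, ‖T (e k) y‖ ^ 2)
    nlinarith
  calc ∑ k, ‖T (e k)‖ ^ 2 = ∫ y, ∑ k, ‖T (e k) y‖ ^ 2 ∂ν := by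
        rw [integral_finsetSum _ fun k _ => integrable_norm_sq _]
        exact Finset.sum_congr rfl fun k _ => norm_sq_eq_integral _
    _ ≤ ∫ _, (1 : ℝ) ∂ν :=
        integral_mono_ae (integrable_finsetSum _ fun k _ => integrable_norm_sq _)
          (integrable_const _) hpt
    _ = 1 := by simp

end Bounded

/-! ### Weak limits along ultrafilters -/

section WeakLimit

variable {E F : Type*} [NormedAddCommGroup E] [InnerProductSpace ℂ E]
  [NormedAddCommGroup F] [InnerProductSpace ℂ F] [CompleteSpace F]

/-- Weak sequential compactness of balls, along an ultrafilter. -/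
theorem exists_norm_le_tendsto_inner {ι : Type*} (l : Ultrafilter ι) {v : ι → F} {r : ℝ}
    (hv : ∀ i, ‖v i‖ ≤ r) :
    ∃ w : F, ‖w‖ ≤ r ∧ ∀ h : F, Tendsto (fun i => ⟪v i, h⟫_ℂ) l (𝓝 ⟪w, h⟫_ℂ) := by
  let φ : ι → WeakDual ℂ F := fun i => StrongDual.toWeakDual (InnerProductSpace.toDual ℂ F (v i))
  have hmem : ∀ᶠ i in (l : Filter ι), φ i ∈ WeakDual.toStrongDual (𝕜 := ℂ) (E := F) ⁻¹'
      Metric.closedBall 0 r :=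
    Eventually.of_forall fun i => by
      rw [Set.mem_preimage, mem_closedBall_zero_iff]
      exact ((InnerProductSpace.toDual ℂ F).norm_map (v i)).trans_le (hv i)
  -- Banach–Alaoglu, transported through the Riesz isomorphism.
  obtain ⟨ψ, hψ, hlim⟩ := (WeakDual.isCompact_closedBall (𝕜 := ℂ) (E := F) 0 r).ultrafilter_le_nhds
    (l.map φ) (Filter.le_principal_iff.2 hmem)
  refine ⟨(InnerProductSpace.toDual ℂ F).symm (WeakDual.toStrongDual ψ), ?_, fun h => ?_⟩
  · rw [LinearIsometryEquiv.norm_map]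
    simpa using hψ
  · rw [InnerProductSpace.toDual_symm_apply]
    exact ((WeakDual.eval_continuous h).tendsto ψ).comp hlim

/-- A bounded family of operators has a limit in the weak operator topology along an
ultrafilter. -/
theorem exists_weak_operator_limit {ι : Type*} (l : Ultrafilter ι) {L : ι → E →L[ℂ] F} {C : ℝ}
    (hL : ∀ i, ‖L i‖ ≤ C) :
    ∃ W : E →L[ℂ] F, ∀ g h, Tendsto (fun i => ⟪h, L i g⟫_ℂ) l (𝓝 ⟪h, W g⟫_ℂ) := by
  have hb : ∀ g i, ‖L i g‖ ≤ C * ‖g‖ := fun g i => (L i).le_of_opNorm_le (hL i) g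
  choose w hw hlim using fun g => exists_norm_le_tendsto_inner l (hb g)
  let W : E →ₗ[ℂ] F :=
    { toFun := w
      map_add' := fun f g => ext_inner_right ℂ fun h => by
        refine tendsto_nhds_unique (hlim (f + g) h) ?_
        rw [inner_add_left]
        simpa only [map_add, inner_add_left] using (hlim f h).add (hlim g h)
      map_smul' := fun c f => ext_inner_right ℂ fun h => by
        refine tendsto_nhds_unique (hlim (c • f) h) ?_
        rw [RingHom.id_apply, inner_smul_left]
        simpa only [map_smul, inner_smul_left] using (hlim f h).const_mul _ }
  refine ⟨W.mkContinuous C hw, fun g h => ?_⟩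
  have h1 := (Complex.continuous_conj.tendsto _).comp (hlim g h)
  simp only [Function.comp_def, inner_conj_symm] at h1
  exact h1

end WeakLimit

/-! ### Intertwining operators and condition (*) -/

section Intertwiner

variable {X : Type*} [MeasurableSpace X] [AddAction ℝ X] [MeasurableConstVAdd ℝ X]
  {μ : Measure X} [IsProbabilityMeasure μ] [ErgodicVAdd ℝ X μ]
  {Y : Type*} [MeasurableSpace Y] [AddAction ℝ Y] [MeasurableConstVAdd ℝ Y]
  {ν : Measure Y} [IsProbabilityMeasure ν] [VAddInvariantMeasure ℝ Y ν]
  {S : ℕ → Set X} {t : ℕ → ℝ} (hS : ∀ i, MeasurableSet (S i))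
  (hinv : ∀ s : ℝ, Tendsto (fun i => μ (symmDiff ((fun x : X => s +ᵥ x) ⁻¹' S i) (S i)))
    atTop (𝓝 0))
  (hrig : ∀ f : Lp ℂ 2 μ,
    Tendsto (fun i => mulInd μ (hS i) (koopman μ (t i) f - f)) atTop (𝓝 0))
  {T : Lp ℂ 2 μ →L[ℂ] Lp ℂ 2 ν} (hT : ∀ s f, T (koopman μ s f) = koopman ν s (T f))

omit [AddAction ℝ Y] [MeasurableConstVAdd ℝ Y] [IsProbabilityMeasure ν]
  [VAddInvariantMeasure ℝ Y ν] in
include hinv in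
theorem tendsto_inner_map_mulInd_sub (f : Lp ℂ 2 μ) (g : Lp ℂ 2 ν) :
    Tendsto (fun i => ⟪g, T (mulInd μ (hS i) f)⟫_ℂ - μ.real (S i) * ⟪g, T f⟫_ℂ) atTop (𝓝 0) := by
  refine (tendsto_inner_mulInd_sub hS hinv f (ContinuousLinearMap.adjoint T g)).congr fun i => ?_
  rw [ContinuousLinearMap.adjoint_inner_left, map_sub, map_smul, inner_sub_right,
    inner_smul_right]

omit [IsProbabilityMeasure ν] in
include hinv hrig hT in
/-- Partial rigidity seen through an intertwining operator. -/
theorem tendsto_inner_koopman_map_mulInd_sub (f : Lp ℂ 2 μ) (g : Lp ℂ 2 ν) :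
    Tendsto (fun i => ⟪koopman ν (t i) g, T (mulInd μ (hS i) f)⟫_ℂ - μ.real (S i) * ⟪g, T f⟫_ℂ)
      atTop (𝓝 0) := by
  -- The translates F^{t_i} S_i have the same measures and are still asymptotically invariant. They
  -- are used because U^{t_i} turns their indicators into those of S_i, where rigidity applies.
  have hS' : ∀ i, MeasurableSet ((fun x : X => -t i +ᵥ x) ⁻¹' S i) := fun i =>
    measurable_const_vadd (-t i) (hS i)
  have hinv' : ∀ s : ℝ, Tendsto (fun i => μ (symmDiff ((fun x : X => s +ᵥ x) ⁻¹'
      ((fun x : X => -t i +ᵥ x) ⁻¹' S i)) ((fun x : X => -t i +ᵥ x) ⁻¹' S i))) atTop (𝓝 0) := by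
    intro s
    refine (hinv s).congr fun i => ?_
    have hm : MeasurableSet (symmDiff ((fun x : X => s +ᵥ x) ⁻¹' S i) (S i)) :=
      (measurable_const_vadd s (hS i)).symmDiff (hS i)
    rw [← (measurePreserving_vadd (-t i) μ).measure_preimage hm.nullMeasurableSet]
    congr 1
    ext x
    simp only [Set.mem_preimage, Set.mem_symmDiff, vadd_vadd, add_comm]
  have hreal : ∀ i, μ.real ((fun x : X => -t i +ᵥ x) ⁻¹' S i) = μ.real (S i) := fun i => by
    rw [measureReal_def, (measurePreserving_vadd (-t i) μ).measure_preimage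
      (hS i).nullMeasurableSet, measureReal_def]
  have h1 := tendsto_inner_map_mulInd_sub (T := T) hS' hinv' f g
  simp only [hreal] at h1
  have h2 : Tendsto (fun i => ⟪koopman ν (t i) g,
      T (mulInd μ (hS i) (koopman μ (t i) f - f))⟫_ℂ) atTop (𝓝 0) := by
    have h3 : Tendsto (fun i => ‖g‖ * ‖T (mulInd μ (hS i) (koopman μ (t i) f - f))‖) atTop
        (𝓝 0) := by
      have h4 := ((T.continuous.tendsto 0).comp (hrig f)).norm.const_mul ‖g‖
      rw [map_zero, norm_zero, mul_zero] at h4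
      exact h4
    refine squeeze_zero_norm (fun i => ?_) h3
    refine (norm_inner_le_norm _ _).trans_eq ?_
    rw [LinearIsometry.norm_map]
  have h5 := h1.sub h2
  rw [sub_zero] at h5
  refine h5.congr fun i => ?_
  have hpre : MeasurableSet ((fun x : X => t i +ᵥ x) ⁻¹' ((fun x : X => -t i +ᵥ x) ⁻¹' S i)) :=
    measurable_const_vadd (t i) (hS' i)
  have hset : (fun x : X => t i +ᵥ x) ⁻¹' ((fun x : X => -t i +ᵥ x) ⁻¹' S i) = S i := by
    ext x
    simp
  have h6 : koopman μ (t i) (mulInd μ (hS' i) f) = mulInd μ (hS i) (koopman μ (t i) f) := by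
    rw [mulInd_koopman (t i) (hS' i) hpre]
    congr 2
  have h7 : ⟪g, T (mulInd μ (hS' i) f)⟫_ℂ =
      ⟪koopman ν (t i) g, T (mulInd μ (hS i) (koopman μ (t i) f))⟫_ℂ := by
    rw [← h6, hT, LinearIsometry.inner_map_map]
  rw [h7, map_sub, map_sub, inner_sub_right]
  ring

variable {c : ℝ} (hc : 0 < c) (hμ : ∀ i, c ≤ μ.real (S i))

omit [AddAction ℝ X] [MeasurableConstVAdd ℝ X] [IsProbabilityMeasure μ] [ErgodicVAdd ℝ X μ] in
include hc hμ in
-- The uniform lower bound c on the measures of the S_i enters here.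
theorem eq_zero_of_tendsto_measureReal_mul {z : ℂ} {l : Filter ℕ} [l.NeBot]
    (h : Tendsto (fun i => (μ.real (S i) : ℂ) * z) l (𝓝 0)) : z = 0 := by
  have h1 := h.norm
  rw [norm_zero] at h1
  have h2 : c * ‖z‖ ≤ 0 := by
    refine ge_of_tendsto' h1 fun i => ?_
    rw [norm_mul, Complex.norm_real, Real.norm_of_nonneg measureReal_nonneg]
    exact mul_le_mul_of_nonneg_right (hμ i) (norm_nonneg _)
  have h3 : ‖z‖ ≤ 0 := by
    by_contra hz
    rw [not_le] at hz
    linarith [mul_pos hc hz]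
  exact norm_le_zero_iff.1 h3

omit [IsProbabilityMeasure ν] in
include hinv hrig hT hc hμ in
/-- The range of an intertwining operator is orthogonal to the nonconstant eigenfunctions. -/
theorem inner_eigenvector_map_eq_zero
    (hstar : ConditionStar ν t) {α : ℝ} {e : Lp ℂ 2 ν} (he : IsEigenvector ν α e)
    (hne : ¬ ∃ a : ℂ, e =ᵐ[ν] fun _ => a) (f : Lp ℂ 2 μ) : ⟪e, T f⟫_ℂ = 0 := by
  obtain ⟨δ, hδ, hδt⟩ := hstar.eigenvalue_away α ⟨e, he, hne⟩
  -- The conjugate appears because the eigenvalue leaves the conjugate-linear first slot.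
  set ω : ℕ → ℂ := fun i => starRingEnd ℂ (Complex.exp (Complex.I * t i * α)) with hω
  have hω1 : ∀ i, ‖ω i‖ = 1 := by
    intro i
    rw [hω, RCLike.norm_conj]
    have h : Complex.I * t i * α = ((t i * α : ℝ) : ℂ) * Complex.I := by push_cast; ring
    rw [h, Complex.norm_exp_ofReal_mul_I]
  have h1 := tendsto_inner_koopman_map_mulInd_sub hS hinv hrig hT f e
  have h2 := tendsto_inner_map_mulInd_sub (T := T) hS hinv f e
  have h3 : Tendsto (fun i => ω i * (⟪e, T (mulInd μ (hS i) f)⟫_ℂ - μ.real (S i) * ⟪e, T f⟫_ℂ))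
      atTop (𝓝 0) := by
    refine squeeze_zero_norm (fun i => ?_) (tendsto_zero_iff_norm_tendsto_zero.1 h2)
    rw [norm_mul, hω1, one_mul]
  have h4 := h1.sub h3
  rw [sub_zero] at h4
  have h5 : Tendsto (fun i => (ω i - 1) * (μ.real (S i) * ⟪e, T f⟫_ℂ)) atTop (𝓝 0) := by
    refine h4.congr fun i => ?_
    rw [he (t i), inner_smul_left]
    simp only [hω]
    ring
  have h8 := (tendsto_zero_iff_norm_tendsto_zero.1 h5).const_mul δ⁻¹
  rw [mul_zero] at h8
  refine eq_zero_of_tendsto_measureReal_mul hc hμ (squeeze_zero_norm (fun i => ?_) h8)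
  have h6 : δ ≤ ‖ω i - 1‖ := by
    have h7 : ω i - 1 = starRingEnd ℂ (Complex.exp (Complex.I * t i * α) - 1) := by
      simp [hω]
    rw [h7, RCLike.norm_conj]
    exact hδt i
  rw [norm_mul (ω i - 1), ← div_eq_inv_mul, le_div_iff₀ hδ, mul_comm]
  exact mul_le_mul_of_nonneg_right h6 (norm_nonneg _)

include hT in
-- T maps coboundaries to coboundaries, which have zero mean. The approximation lemma is applied to
-- a constant sequence of functionals. This handles the constant eigenfunctions, which (*) does not
-- cover.
theorem inner_oneL2_map_eq_zero {f : Lp ℂ 2 μ} (hf : ⟪oneL2 μ, f⟫_ℂ = 0) :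
    ⟪oneL2 ν, T f⟫_ℂ = 0 := by
  have h := tendsto_zero_of_coboundaries (l := (atTop : Filter ℕ))
    (L := fun _ => (innerSL ℂ (oneL2 ν)).comp T) (fun _ => le_rfl) (fun s z => ?_) hf
  · exact tendsto_nhds_unique tendsto_const_nhds h
  · have h0 : ⟪oneL2 ν, T (koopman μ s z - z)⟫_ℂ = 0 := by
      rw [map_sub, hT, inner_sub_right, ← koopman_oneL2 (m := ν) s, LinearIsometry.inner_map_map,
        koopman_oneL2, sub_self]
    simp only [ContinuousLinearMap.comp_apply, innerSL_apply_apply, h0]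
    exact tendsto_const_nhds

include hinv hrig hT hc hμ in
/-- An intertwining operator maps functions of zero mean into the continuous-spectrum subspace. -/
theorem map_mem_continuousPart (hstar : ConditionStar ν t) {f : Lp ℂ 2 μ}
    (hf : ⟪oneL2 μ, f⟫_ℂ = 0) : T f ∈ continuousPart ν := by
  rw [continuousPart, purePoint, Submodule.orthogonal_closure, Submodule.mem_orthogonal]
  intro e he
  induction he using Submodule.span_induction with
  | mem e he =>
    obtain ⟨α, he⟩ := he
    by_cases hne : ∃ a : ℂ, e =ᵐ[ν] fun _ => a
    · obtain ⟨a, ha⟩ := hne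
      rw [(eq_smul_oneL2_iff e a).2 ha, inner_smul_left, inner_oneL2_map_eq_zero hT hf, mul_zero]
    · exact inner_eigenvector_map_eq_zero hS hinv hrig hT hc hμ hstar he hne f
  | zero => exact inner_zero_left _
  | add x y _ _ hx hy => rw [inner_add_left, hx, hy, add_zero]
  | smul a x _ hx => rw [inner_smul_left, hx, mul_zero]

include hinv hrig hT hc hμ in
/-- A Hilbert–Schmidt intertwining operator vanishes on functions of zero mean. -/
theorem map_eq_zero_of_hilbertSchmidt (hstar : ConditionStar ν t) {C : ℝ}
    (hHS : ∀ (n : ℕ) (e : Fin n → Lp ℂ 2 μ), Orthonormal ℂ e → ∑ k, ‖T (e k)‖ ^ 2 ≤ C)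
    {f : Lp ℂ 2 μ} (hf : ⟪oneL2 μ, f⟫_ℂ = 0) : T f = 0 := by
  have hmem := map_mem_continuousPart hS hinv hrig hT hc hμ hstar hf
  set u : ℕ → Lp ℂ 2 μ := fun i => mulInd μ (hS i) f - (μ.real (S i) : ℂ) • f with hu
  have hub : ∀ i, ‖u i‖ ≤ 2 * ‖f‖ := by
    intro i
    refine (norm_sub_le _ _).trans ?_
    rw [norm_smul, Complex.norm_real, Real.norm_of_nonneg measureReal_nonneg, two_mul]
    exact add_le_add (norm_mulInd_apply_le _ _)
      (mul_le_of_le_one_left (norm_nonneg _) measureReal_le_one)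
  have hTu := tendsto_map_zero_of_hilbertSchmidt hHS hub fun z =>
    tendsto_inner_mulInd_sub hS hinv f z
  set g := T f with hg
  have h1 : Tendsto (fun i => ⟪koopman ν (t i) g, T (u i)⟫_ℂ) atTop (𝓝 0) := by
    have h2 := (tendsto_zero_iff_norm_tendsto_zero.1 hTu).const_mul ‖g‖
    rw [mul_zero] at h2
    refine squeeze_zero_norm (fun i => (norm_inner_le_norm _ _).trans_eq ?_) h2
    rw [LinearIsometry.norm_map]
  have h3 : Tendsto (fun i => (μ.real (S i) : ℂ) * ⟪koopman ν (t i) g, g⟫_ℂ) atTop (𝓝 0) := by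
    have h4 := (Complex.continuous_conj.tendsto 0).comp (hstar.tendsto_weakly g hmem g)
    rw [map_zero] at h4
    refine squeeze_zero_norm (fun i => ?_) (tendsto_zero_iff_norm_tendsto_zero.1 h4)
    rw [norm_mul, Complex.norm_real, Real.norm_of_nonneg measureReal_nonneg, Function.comp_apply,
      inner_conj_symm]
    exact mul_le_of_le_one_left (norm_nonneg _) measureReal_le_one
  have h5 := tendsto_inner_koopman_map_mulInd_sub hS hinv hrig hT f g
  have h6 := (h1.add h3).sub h5
  rw [add_zero, sub_zero] at h6
  have h7 : ⟪g, g⟫_ℂ = 0 := by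
    refine eq_zero_of_tendsto_measureReal_mul hc hμ (h6.congr fun i => ?_)
    simp only [hu, map_sub, map_smul, inner_sub_right, inner_smul_right, ← hg]
    ring
  exact inner_self_eq_zero.1 h7

end Intertwiner

/-! ### Absolute values and pointwise domination in L² -/

section Abs

variable {Y : Type*} [MeasurableSpace Y] {ν : Measure Y}

theorem memLp_ofReal_norm (f : Lp ℂ 2 ν) : MemLp (fun y => ((‖f y‖ : ℝ) : ℂ)) 2 ν :=
  (Lp.memLp f).norm.ofReal

/-- The absolute value of an `L²` function. -/
noncomputable def absL2 (f : Lp ℂ 2 ν) : Lp ℂ 2 ν :=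
  (memLp_ofReal_norm f).toLp _

theorem coeFn_absL2 (f : Lp ℂ 2 ν) : absL2 f =ᵐ[ν] fun y => ((‖f y‖ : ℝ) : ℂ) :=
  MemLp.coeFn_toLp (memLp_ofReal_norm f)

theorem norm_absL2 (f : Lp ℂ 2 ν) : ‖absL2 f‖ = ‖f‖ := by
  have h : ∀ᵐ y ∂ν, ‖absL2 f y‖ = ‖f y‖ := by
    filter_upwards [coeFn_absL2 f] with y hy
    rw [hy]
    simp
  exact le_antisymm (Lp.norm_le_norm_of_ae_le (h.mono fun y hy => hy.le))
    (Lp.norm_le_norm_of_ae_le (h.mono fun y hy => hy.ge))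

theorem inner_oneL2_absL2 [IsProbabilityMeasure ν] (f : Lp ℂ 2 ν) : ∃ r : ℝ, ⟪oneL2 ν, absL2 f⟫_ℂ = r ∧ r ≤ ‖f‖ := by
  have h : ⟪oneL2 ν, absL2 f⟫_ℂ = ((∫ y, ‖f y‖ ∂ν : ℝ) : ℂ) := by
    rw [inner_oneL2_left, ← integral_complex_ofReal]
    exact integral_congr_ae (coeFn_absL2 f)
  refine ⟨_, h, ?_⟩
  have h1 := norm_inner_le_norm (𝕜 := ℂ) (oneL2 ν) (absL2 f)
  rw [h, Complex.norm_real, norm_oneL2, one_mul, norm_absL2] at h1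
  exact (Real.le_norm_self _).trans h1

theorem integrable_norm_mul_norm (a b : Lp ℂ 2 ν) : Integrable (fun y => ‖a y‖ * ‖b y‖) ν :=
  (Lp.memLp a).norm.integrable_mul (Lp.memLp b).norm

theorem inner_absL2_left (a b : Lp ℂ 2 ν) : ⟪absL2 a, b⟫_ℂ = ∫ y, (‖a y‖ : ℂ) * b y ∂ν := by
  rw [L2.inner_def]
  refine integral_congr_ae ?_
  filter_upwards [coeFn_absL2 a] with y hy
  rw [hy, RCLike.inner_apply, Complex.conj_ofReal, mul_comm]

theorem re_inner_absL2_left (a b : Lp ℂ 2 ν) :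
    (⟪absL2 a, b⟫_ℂ).re = ∫ y, ‖a y‖ * (b y).re ∂ν := by
  have h : Integrable (fun y => (‖a y‖ : ℂ) * b y) ν :=
    (memLp_ofReal_norm a).integrable_mul (Lp.memLp b)
  rw [inner_absL2_left]
  have h1 := integral_re (𝕜 := ℂ) h
  simp only [RCLike.re_eq_complex_re, Complex.re_ofReal_mul] at h1
  exact h1.symm

theorem re_inner_absL2_absL2 (a b : Lp ℂ 2 ν) :
    (⟪absL2 a, absL2 b⟫_ℂ).re = ∫ y, ‖a y‖ * ‖b y‖ ∂ν := by
  rw [re_inner_absL2_left]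
  refine integral_congr_ae ?_
  filter_upwards [coeFn_absL2 b] with y hy
  rw [hy, Complex.ofReal_re]

theorem norm_inner_le_re_inner_absL2 (a b : Lp ℂ 2 ν) :
    ‖⟪a, b⟫_ℂ‖ ≤ (⟪absL2 a, absL2 b⟫_ℂ).re := by
  rw [re_inner_absL2_absL2, L2.inner_def]
  refine norm_integral_le_of_norm_le (integrable_norm_mul_norm a b)
    (Eventually.of_forall fun y => norm_inner_le_norm _ _)

theorem re_inner_absL2_mono_right (a : Lp ℂ 2 ν) {b w : Lp ℂ 2 ν}
    (h : ∀ᵐ y ∂ν, ‖b y‖ ≤ (w y).re) :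
    (⟪absL2 a, absL2 b⟫_ℂ).re ≤ (⟪absL2 a, w⟫_ℂ).re := by
  rw [re_inner_absL2_absL2, re_inner_absL2_left]
  refine integral_mono_ae (integrable_norm_mul_norm a b)
    ((Lp.memLp a).norm.integrable_mul (Lp.memLp w).re) ?_
  filter_upwards [h] with y hy
  exact mul_le_mul_of_nonneg_left hy (norm_nonneg _)

theorem norm_inner_mulInd_mulInd_le {S S' : Set Y} (hS : MeasurableSet S)
    (hS' : MeasurableSet S') (a b : Lp ℂ 2 ν) :
    ‖⟪mulInd ν hS a, mulInd ν hS' b⟫_ℂ‖ ≤ (⟪absL2 a, absL2 b⟫_ℂ).re := by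
  refine (norm_inner_le_re_inner_absL2 _ _).trans ?_
  rw [re_inner_absL2_absL2, re_inner_absL2_absL2]
  refine integral_mono_ae (integrable_norm_mul_norm _ _) (integrable_norm_mul_norm a b) ?_
  filter_upwards [coeFn_mulInd hS a, coeFn_mulInd hS' b] with y h1 h2
  rw [h1, h2]
  exact mul_le_mul (norm_indicator_le_norm_self _ _) (norm_indicator_le_norm_self _ _)
    (norm_nonneg _) (norm_nonneg _)

/-- A pointwise bound follows from the corresponding bound on inner products. -/
theorem ae_norm_le_re_of_norm_inner_le [IsFiniteMeasure ν] {v w : Lp ℂ 2 ν}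
    (H : ∀ h : Lp ℂ 2 ν, ‖⟪h, v⟫_ℂ‖ ≤ (⟪absL2 h, w⟫_ℂ).re) : ∀ᵐ y ∂ν, ‖v y‖ ≤ (w y).re := by
  have hE : MeasurableSet {y | (w y).re < ‖v y‖} :=
    measurableSet_lt (Complex.measurable_re.comp (Lp.stronglyMeasurable w).measurable)
      (Lp.stronglyMeasurable v).measurable.norm
  set E := {y | (w y).re < ‖v y‖}
  have hvm := (Lp.stronglyMeasurable v).measurable
  -- The phase of v, set to 1 where v vanishes so that |σ| = 1 everywhere. Testing with 1_E σ gives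
  -- ∫_E |v| ≤ ∫_E Re w, which forces E to be null.
  let σ : Y → ℂ := fun y => if v y = 0 then 1 else v y / ‖v y‖
  have hσ1 : ∀ y, ‖σ y‖ = 1 := by
    intro y
    by_cases hy : v y = 0 <;> simp [σ, hy]
  have hσv : ∀ y, ⟪σ y, v y⟫_ℂ = (‖v y‖ : ℂ) := by
    intro y
    by_cases hy : v y = 0
    · simp [hy]
    · have hn : (‖v y‖ : ℂ) ≠ 0 := by simpa using hy
      simp only [σ, hy, if_false, RCLike.inner_apply, map_div₀, Complex.conj_ofReal]
      rw [mul_div_assoc', Complex.mul_conj', sq, mul_div_assoc, div_self hn, mul_one]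
  have hσm : Measurable σ := by
    refine Measurable.ite (hvm (measurableSet_singleton 0)) measurable_const ?_
    exact hvm.div (Complex.measurable_ofReal.comp hvm.norm)
  have hσL : MemLp σ 2 ν :=
    MemLp.of_bound hσm.aestronglyMeasurable 1 (Eventually.of_forall fun y => (hσ1 y).le)
  have h1 := H (mulInd ν hE (hσL.toLp σ))
  have hl : ⟪mulInd ν hE (hσL.toLp σ), v⟫_ℂ = ((∫ y in E, ‖v y‖ ∂ν : ℝ) : ℂ) := by
    rw [inner_mulInd_left, inner_mulInd_right, ← integral_complex_ofReal]
    refine integral_congr_ae ?_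
    filter_upwards [ae_restrict_of_ae hσL.coeFn_toLp] with y hy
    rw [hy, hσv]
  have hr : (⟪absL2 (mulInd ν hE (hσL.toLp σ)), w⟫_ℂ).re = ∫ y in E, (w y).re ∂ν := by
    rw [re_inner_absL2_left, ← integral_indicator hE]
    refine integral_congr_ae ?_
    filter_upwards [coeFn_mulInd hE (hσL.toLp σ), hσL.coeFn_toLp] with y hy hy'
    rw [hy]
    by_cases h : y ∈ E <;> simp [h, hy', hσ1]
  rw [hl, hr, Complex.norm_real] at h1
  have hi1 : IntegrableOn (fun y => ‖v y‖) E ν :=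
    ((Lp.memLp v).integrable (by norm_num)).norm.integrableOn
  have hi2 : IntegrableOn (fun y => (w y).re) E ν :=
    ((Lp.memLp w).integrable (by norm_num)).re.integrableOn
  have h2 : ∫ y in E, (‖v y‖ - (w y).re) ∂ν ≤ 0 := by
    rw [integral_sub hi1 hi2]
    linarith [Real.le_norm_self (∫ y in E, ‖v y‖ ∂ν)]
  have hnn : 0 ≤ᵐ[ν.restrict E] fun y => ‖v y‖ - (w y).re := by
    filter_upwards [ae_restrict_mem hE] with y hy
    have hy' : (w y).re < ‖v y‖ := hy
    rw [Pi.zero_apply]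
    linarith
  have h3 := (integral_eq_zero_iff_of_nonneg_ae hnn (hi1.sub hi2)).1
    (le_antisymm h2 (integral_nonneg_of_ae hnn))
  rw [EventuallyEq, ae_restrict_iff' hE] at h3
  filter_upwards [h3] with y hy
  by_contra hlt
  rw [not_le] at hlt
  have h4 : ‖v y‖ - (w y).re = 0 := hy hlt
  linarith

end Abs

/-! ### Pullback along factor maps -/

section AbsKoopman

variable {Z : Type*} [MeasurableSpace Z] {m : Measure Z} {Ω : Type*} [MeasurableSpace Ω]
  {ρ : Measure Ω} {p : Ω → Z}

/-- Composition with a measure preserving map, as an isometry of `L²` spaces. -/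
noncomputable def pull (hp : MeasurePreserving p ρ m) : Lp ℂ 2 m →ₗᵢ[ℂ] Lp ℂ 2 ρ :=
  Lp.compMeasurePreservingₗᵢ ℂ p hp

variable (hp : MeasurePreserving p ρ m)

theorem coeFn_pull (f : Lp ℂ 2 m) : pull hp f =ᵐ[ρ] fun ω => f (p ω) :=
  Lp.coeFn_compMeasurePreserving f hp

theorem absL2_pull (f : Lp ℂ 2 m) : absL2 (pull hp f) = pull hp (absL2 f) := by
  refine Lp.ext ?_
  filter_upwards [coeFn_absL2 (pull hp f), coeFn_pull hp f, coeFn_pull hp (absL2 f),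
    hp.quasiMeasurePreserving.ae (coeFn_absL2 f)] with ω h1 h2 h3 h4
  rw [h1, h2, h3, h4]

theorem pull_oneL2 [IsProbabilityMeasure m] [IsProbabilityMeasure ρ] :
    pull hp (oneL2 m) = oneL2 ρ := by
  refine Lp.ext ?_
  filter_upwards [coeFn_pull hp (oneL2 m), coeFn_oneL2 ρ,
    hp.quasiMeasurePreserving.ae (coeFn_oneL2 m)] with ω h1 h2 h3
  rw [h1, h2, h3]

theorem mulInd_pull {S : Set Z} (hS : MeasurableSet S) (hS' : MeasurableSet (p ⁻¹' S))
    (f : Lp ℂ 2 m) : mulInd ρ hS' (pull hp f) = pull hp (mulInd m hS f) := by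
  refine Lp.ext ?_
  filter_upwards [coeFn_mulInd hS' (pull hp f), coeFn_pull hp f, coeFn_pull hp (mulInd m hS f),
    hp.quasiMeasurePreserving.ae (coeFn_mulInd hS f)] with ω h1 h2 h3 h4
  rw [h1, h3, h4]
  by_cases h : p ω ∈ S <;> simp [h, h2]

variable [AddAction ℝ Z] [MeasurableConstVAdd ℝ Z] [VAddInvariantMeasure ℝ Z m]

theorem absL2_koopman (s : ℝ) (f : Lp ℂ 2 m) :
    absL2 (koopman m s f) = koopman m s (absL2 f) :=
  absL2_pull (measurePreserving_vadd s m) f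

theorem pull_koopman [AddAction ℝ Ω] [MeasurableConstVAdd ℝ Ω] [VAddInvariantMeasure ℝ Ω ρ]
    (hequi : ∀ (s : ℝ) (ω : Ω), p (s +ᵥ ω) = s +ᵥ p ω) (s : ℝ) (f : Lp ℂ 2 m) :
    pull hp (koopman m s f) = koopman ρ s (pull hp f) := by
  refine Lp.ext ?_
  filter_upwards [coeFn_pull hp (koopman m s f), coeFn_koopman s (pull hp f),
    hp.quasiMeasurePreserving.ae (coeFn_koopman s f),
    (measurePreserving_vadd s ρ).quasiMeasurePreserving.ae (coeFn_pull hp f)] with ω h1 h2 h3 h4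
  rw [h1, h2, h3, h4, hequi]

end AbsKoopman

/-! ### The Markov operator of a coupling -/

section Markov

variable {X Y Ω : Type*} [MeasurableSpace X] [MeasurableSpace Y] [MeasurableSpace Ω]
  {μ : Measure X} {ν : Measure Y} {ρ : Measure Ω} {p : Ω → X} {q : Ω → Y}
  (hp : MeasurePreserving p ρ μ) (hq : MeasurePreserving q ρ ν)

/-- The Markov operator `L²(μ) → L²(ν)` of a coupling: pull back along the first factor map and
take the conditional expectation with respect to the second. -/
noncomputable def markov : Lp ℂ 2 μ →L[ℂ] Lp ℂ 2 ν :=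
  (ContinuousLinearMap.adjoint (pull hq).toContinuousLinearMap).comp
    (pull hp).toContinuousLinearMap

theorem inner_markov (f : Lp ℂ 2 μ) (h : Lp ℂ 2 ν) :
    ⟪h, markov hp hq f⟫_ℂ = ⟪pull hq h, pull hp f⟫_ℂ := by
  rw [markov, ContinuousLinearMap.comp_apply, ContinuousLinearMap.adjoint_inner_right]
  rfl

/-- Positivity: moving absolute values inside the inner product in L²(ρ) only increases it, and they
commute with pullback. -/
theorem norm_markov_le_re [IsFiniteMeasure ν] (f : Lp ℂ 2 μ) :
    ∀ᵐ y ∂ν, ‖markov hp hq f y‖ ≤ (markov hp hq (absL2 f) y).re := by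
  refine ae_norm_le_re_of_norm_inner_le fun h => ?_
  rw [inner_markov, inner_markov, ← absL2_pull, ← absL2_pull]
  exact norm_inner_le_re_inner_absL2 _ _

theorem markov_oneL2 [IsProbabilityMeasure μ] [IsProbabilityMeasure ν] [IsProbabilityMeasure ρ] :
    markov hp hq (oneL2 μ) = oneL2 ν := by
  refine ext_inner_left ℂ fun h => ?_
  rw [inner_markov, pull_oneL2, ← pull_oneL2 hq, LinearIsometry.inner_map_map]

variable [AddAction ℝ X] [MeasurableConstVAdd ℝ X] [VAddInvariantMeasure ℝ X μ]
  [AddAction ℝ Y] [MeasurableConstVAdd ℝ Y] [VAddInvariantMeasure ℝ Y ν]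
  [AddAction ℝ Ω] [MeasurableConstVAdd ℝ Ω] [VAddInvariantMeasure ℝ Ω ρ]

theorem markov_koopman (hpe : ∀ (s : ℝ) (ω : Ω), p (s +ᵥ ω) = s +ᵥ p ω)
    (hqe : ∀ (s : ℝ) (ω : Ω), q (s +ᵥ ω) = s +ᵥ q ω) (s : ℝ) (f : Lp ℂ 2 μ) :
    markov hp hq (koopman μ s f) = koopman ν s (markov hp hq f) := by
  refine ext_inner_left ℂ fun h => ?_
  have h1 := inner_koopman_left (-s) h (markov hp hq f)
  rw [neg_neg] at h1
  rw [← h1, inner_markov, inner_markov, pull_koopman hp hpe, pull_koopman hq hqe,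
    inner_koopman_left, neg_neg]

end Markov

/-! ### The cut-and-shift operators V_i -/

section CutShift

variable {X Y Ω : Type*} [MeasurableSpace X] [MeasurableSpace Y] [MeasurableSpace Ω]
  {μ : Measure X} {ν : Measure Y} {ρ : Measure Ω} {p : Ω → X} {q : Ω → Y}
  [AddAction ℝ Y] [MeasurableConstVAdd ℝ Y] [VAddInvariantMeasure ℝ Y ν]
  (hp : MeasurePreserving p ρ μ) (hq : MeasurePreserving q ρ ν)

/-- The operator `g ↦ 1_S(x) g(F^s y)` from `L²(ν)` to `L²(ρ)`. -/
noncomputable def cutShift {A : Set X} (hA : MeasurableSet A) (s : ℝ) :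
    Lp ℂ 2 ν →L[ℂ] Lp ℂ 2 ρ :=
  (mulInd ρ (hp.measurable hA)).comp
    ((pull hq).toContinuousLinearMap.comp (koopman ν s).toContinuousLinearMap)

theorem cutShift_apply {A : Set X} (hA : MeasurableSet A) (s : ℝ) (g : Lp ℂ 2 ν) :
    cutShift hp hq hA s g = mulInd ρ (hp.measurable hA) (pull hq (koopman ν s g)) := rfl

theorem norm_cutShift_le {A : Set X} (hA : MeasurableSet A) (s : ℝ) :
    ‖cutShift hp hq hA s‖ ≤ 1 := by
  refine ContinuousLinearMap.opNorm_le_bound _ zero_le_one fun g => ?_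
  rw [cutShift_apply, one_mul]
  refine (norm_mulInd_apply_le _ _).trans_eq ?_
  rw [LinearIsometry.norm_map, LinearIsometry.norm_map]

/-- Once absolute values are taken the indicators can be dropped, leaving an inner product on Y
alone. -/
theorem norm_inner_cutShift_le {A B : Set X} (hA : MeasurableSet A) (hB : MeasurableSet B)
    (r s : ℝ) (h : Lp ℂ 2 ν) {g w : Lp ℂ 2 ν} (hw : ∀ᵐ y ∂ν, ‖g y‖ ≤ (w y).re) :
    ‖⟪cutShift hp hq hA r h, cutShift hp hq hB s g⟫_ℂ‖ ≤
      (⟪absL2 (koopman ν r h), koopman ν s w⟫_ℂ).re := by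
  rw [cutShift_apply, cutShift_apply]
  refine (norm_inner_mulInd_mulInd_le _ _ _ _).trans ?_
  rw [absL2_pull, absL2_pull, LinearIsometry.inner_map_map]
  refine re_inner_absL2_mono_right _ ?_
  filter_upwards [coeFn_koopman s g, coeFn_koopman s w,
    (measurePreserving_vadd s ν).quasiMeasurePreserving.ae hw] with y h1 h2 h3
  rwa [h1, h2]

end CutShift

/-! ### Independence of the factors -/

section Coupling

variable {X Y Ω : Type*} [MeasurableSpace X] [MeasurableSpace Y] [MeasurableSpace Ω]
  {μ : Measure X} {ν : Measure Y} {ρ : Measure Ω} {p : Ω → X} {q : Ω → Y}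
  [IsProbabilityMeasure μ] [IsProbabilityMeasure ν] [IsProbabilityMeasure ρ]
  [AddAction ℝ X] [MeasurableConstVAdd ℝ X] [ErgodicVAdd ℝ X μ]
  [AddAction ℝ Y] [MeasurableConstVAdd ℝ Y] [VAddInvariantMeasure ℝ Y ν]
  [AddAction ℝ Ω] [MeasurableConstVAdd ℝ Ω] [VAddInvariantMeasure ℝ Ω ρ]
  (hp : MeasurePreserving p ρ μ) (hq : MeasurePreserving q ρ ν)
  (hpe : ∀ (s : ℝ) (ω : Ω), p (s +ᵥ ω) = s +ᵥ p ω)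
  (hqe : ∀ (s : ℝ) (ω : Ω), q (s +ᵥ ω) = s +ᵥ q ω)
  {S : ℕ → Set X} {t : ℕ → ℝ} (hS : ∀ i, MeasurableSet (S i))
  (hinv : ∀ s : ℝ, Tendsto (fun i => μ (symmDiff ((fun x : X => s +ᵥ x) ⁻¹' S i) (S i)))
    atTop (𝓝 0))
  (hrig : ∀ f : Lp ℂ 2 μ,
    Tendsto (fun i => mulInd μ (hS i) (koopman μ (t i) f - f)) atTop (𝓝 0))
  {c : ℝ} (hc : 0 < c) (hμ : ∀ i, c ≤ μ.real (S i)) (hstar : ConditionStar ν t)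


omit [IsProbabilityMeasure μ] [IsProbabilityMeasure ν] [IsProbabilityMeasure ρ]
  [ErgodicVAdd ℝ X μ] in
include hpe hqe hinv in
/-- Weak limits of the operators `1_{S_i}(x) g(F^{t_i} y)` intertwine the flows. -/
theorem weak_limit_cutShift_koopman {l : Filter ℕ} [l.NeBot] (hl : l ≤ atTop)
    {W : Lp ℂ 2 ν →L[ℂ] Lp ℂ 2 ρ}
    (hW : ∀ g h, Tendsto (fun i => ⟪h, cutShift hp hq (hS i) (t i) g⟫_ℂ) l (𝓝 ⟪h, W g⟫_ℂ))
    (s : ℝ) (g : Lp ℂ 2 ν) : W (koopman ν s g) = koopman ρ s (W g) := by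
  refine ext_inner_left ℂ fun h => ?_
  have h1 := hW (koopman ν s g) h
  have h2 := hW g (koopman ρ (-s) h)
  rw [inner_koopman_left, neg_neg] at h2
  have hP : ∀ i, MeasurableSet (p ⁻¹' S i) := fun i => hp.measurable (hS i)
  have hP' : ∀ i, MeasurableSet ((fun ω : Ω => s +ᵥ ω) ⁻¹' (p ⁻¹' S i)) := fun i =>
    measurable_const_vadd s (hP i)
  have hD : Tendsto (fun i => ρ (symmDiff (p ⁻¹' S i) ((fun ω : Ω => s +ᵥ ω) ⁻¹' (p ⁻¹' S i))))
      l (𝓝 0) := by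
    refine ((hinv s).mono_left hl).congr fun i => ?_
    have hm : MeasurableSet (symmDiff ((fun x : X => s +ᵥ x) ⁻¹' S i) (S i)) :=
      (measurable_const_vadd s (hS i)).symmDiff (hS i)
    rw [← hp.measure_preimage hm.nullMeasurableSet, symmDiff_comm (p ⁻¹' S i)]
    congr 1
    ext ω
    simp only [Set.mem_preimage, Set.mem_symmDiff, hpe]
  have h3 := (tendsto_zero_iff_norm_tendsto_zero.1
    (tendsto_mulInd_zero (fun i => (hP i).symmDiff (hP' i)) hD h)).mul_const ‖g‖
  rw [zero_mul] at h3
  refine sub_eq_zero.1 (tendsto_nhds_unique (h1.sub h2) (squeeze_zero_norm (fun i => ?_) h3))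
  -- Both sides pair h with the same b, of norm ‖g‖, cut by p⁻¹S_i or by its translate.
  set b := pull hq (koopman ν (s + t i) g) with hb
  have e1 : cutShift hp hq (hS i) (t i) (koopman ν s g) = mulInd ρ (hP i) b := by
    rw [cutShift_apply, koopman_koopman, add_comm]
  have e2 : ⟪koopman ρ (-s) h, cutShift hp hq (hS i) (t i) g⟫_ℂ = ⟪h, mulInd ρ (hP' i) b⟫_ℂ := by
    rw [inner_koopman_left, neg_neg, cutShift_apply, mulInd_koopman s (hP i) (hP' i),
      ← pull_koopman hq hqe, koopman_koopman]
  rw [e1, e2, ← inner_mulInd_left, ← inner_mulInd_left, ← inner_sub_left]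
  refine (norm_inner_le_norm _ _).trans ?_
  rw [hb, LinearIsometry.norm_map, LinearIsometry.norm_map]
  exact mul_le_mul_of_nonneg_right (norm_mulInd_sub_le _ _ _) (norm_nonneg _)

include hpe hqe hinv hrig hc hμ hstar in
/-- The flow on `Y` mixes the range of the Markov operator along the sequence `t`. -/
theorem tendsto_inner_koopman_markov (f : Lp ℂ 2 μ) (b : Lp ℂ 2 ν) :
    Tendsto (fun i => ⟪b, koopman ν (t i) (markov hp hq f)⟫_ℂ) atTop
      (𝓝 (⟪b, oneL2 ν⟫_ℂ * ⟪oneL2 μ, f⟫_ℂ)) := by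
  have hf : ⟪oneL2 μ, f - ⟪oneL2 μ, f⟫_ℂ • oneL2 μ⟫_ℂ = 0 := by
    rw [inner_sub_right, inner_smul_right, inner_oneL2_self, mul_one, sub_self]
  have h1 := hstar.tendsto_weakly _ (map_mem_continuousPart hS hinv hrig
    (markov_koopman hp hq hpe hqe) hc hμ hstar hf) b
  have h2 := h1.add_const (⟪b, oneL2 ν⟫_ℂ * ⟪oneL2 μ, f⟫_ℂ)
  rw [zero_add] at h2
  refine h2.congr fun i => ?_
  rw [map_sub, map_smul, markov_oneL2, map_sub, map_smul, koopman_oneL2, inner_sub_right,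
    inner_smul_right]
  ring

include hpe hqe hinv hrig hc hμ hstar in
-- By positivity, |⟨V_i h, V_j A f⟩| ≤ ⟨|U^{t_i} h|, U^{t_j} A|f|⟩, and mixing on the range of A
-- decouples this into ∫|h| · ∫|f| as j grows. This is the L²-to-L^∞ bound for W*WA.
theorem norm_inner_weak_limit_le {l : Filter ℕ} [l.NeBot] (hl : l ≤ atTop)
    {W : Lp ℂ 2 ν →L[ℂ] Lp ℂ 2 ρ}
    (hW : ∀ g h, Tendsto (fun i => ⟪h, cutShift hp hq (hS i) (t i) g⟫_ℂ) l (𝓝 ⟪h, W g⟫_ℂ))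
    (f : Lp ℂ 2 μ) (h : Lp ℂ 2 ν) :
    ‖⟪W h, W (markov hp hq f)⟫_ℂ‖ ≤ (⟪absL2 h, (‖f‖ : ℂ) • oneL2 ν⟫_ℂ).re := by
  set g := markov hp hq f with hg
  obtain ⟨r, hr, hrf⟩ := inner_oneL2_absL2 f
  -- Iterated limits: j varies first with i fixed, producing W g; then i varies, producing W h.
  have hi : ∀ i, ‖⟪cutShift hp hq (hS i) (t i) h, W g⟫_ℂ‖ ≤
      (⟪absL2 h, (‖f‖ : ℂ) • oneL2 ν⟫_ℂ).re := by
    intro i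
    have h1 := (hW g (cutShift hp hq (hS i) (t i) h)).norm
    have h2 := (Complex.continuous_re.tendsto _).comp ((tendsto_inner_koopman_markov hp hq hpe hqe
      hS hinv hrig hc hμ hstar (absL2 f) (absL2 (koopman ν (t i) h))).mono_left hl)
    refine (le_of_tendsto_of_tendsto' h1 h2 fun j =>
      norm_inner_cutShift_le hp hq (hS i) (hS j) (t i) (t j) h (norm_markov_le_re hp hq f)).trans ?_
    have h3 : ⟪absL2 (koopman ν (t i) h), oneL2 ν⟫_ℂ = ⟪absL2 h, oneL2 ν⟫_ℂ := by
      rw [absL2_koopman, ← koopman_oneL2 (m := ν) (t i), LinearIsometry.inner_map_map,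
        koopman_oneL2]
    have h4 : 0 ≤ (⟪absL2 h, oneL2 ν⟫_ℂ).re := by
      rw [re_inner_absL2_left]
      refine integral_nonneg_of_ae ?_
      filter_upwards [coeFn_oneL2 ν] with y hy
      rw [hy, Complex.one_re, mul_one]
      exact norm_nonneg _
    rw [h3, hr, inner_smul_right, mul_comm, Complex.re_ofReal_mul, Complex.re_ofReal_mul]
    exact mul_le_mul_of_nonneg_right hrf h4
  refine le_of_tendsto' (x := l) ?_ hi
  have h5 := (hW h (W g)).norm
  rw [norm_inner_symm] at h5
  exact h5.congr fun i => norm_inner_symm _ _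

include hpe hqe hinv hrig hc hμ hstar in
/-- The Markov operator of a coupling of the two flows vanishes on functions of zero mean. -/
theorem markov_eq_zero {f : Lp ℂ 2 μ} (hf : ⟪oneL2 μ, f⟫_ℂ = 0) : markov hp hq f = 0 := by
  -- L²(ν) need not be separable, so the limit is along a nonprincipal ultrafilter, not a
  -- subsequence.
  have hl : ((hyperfilter ℕ : Ultrafilter ℕ) : Filter ℕ) ≤ atTop := Nat.hyperfilter_le_atTop
  obtain ⟨W, hW⟩ := exists_weak_operator_limit (hyperfilter ℕ)
    (fun i => norm_cutShift_le hp hq (hS i) (t i))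
  have hWk := weak_limit_cutShift_koopman hp hq hpe hqe hS hinv hl hW
  have hAk := markov_koopman hp hq hpe hqe
  let T : Lp ℂ 2 μ →L[ℂ] Lp ℂ 2 ν :=
    (ContinuousLinearMap.adjoint W).comp (W.comp (markov hp hq))
  have hTin : ∀ f h, ⟪h, T f⟫_ℂ = ⟪W h, W (markov hp hq f)⟫_ℂ := fun f h => by
    simp only [T, ContinuousLinearMap.comp_apply]
    rw [ContinuousLinearMap.adjoint_inner_right]
  have hTk : ∀ s f, T (koopman μ s f) = koopman ν s (T f) := by
    intro s f
    refine ext_inner_left ℂ fun h => ?_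
    have h1 := inner_koopman_left (-s) h (T f)
    rw [neg_neg] at h1
    rw [← h1, hTin, hTin, hAk, hWk, hWk, inner_koopman_left, neg_neg]
  have hTae : ∀ f : Lp ℂ 2 μ, ∀ᵐ y ∂ν, ‖T f y‖ ≤ ‖f‖ := by
    intro f
    have h1 : ∀ᵐ y ∂ν, ‖T f y‖ ≤ (((‖f‖ : ℂ) • oneL2 ν : Lp ℂ 2 ν) y).re := by
      refine ae_norm_le_re_of_norm_inner_le fun h => ?_
      rw [hTin]
      exact norm_inner_weak_limit_le hp hq hpe hqe hS hinv hrig hc hμ hstar hl hW f h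
    filter_upwards [h1, (eq_smul_oneL2_iff ((‖f‖ : ℂ) • oneL2 ν) (‖f‖ : ℂ)).1 rfl] with y h2 h3
    rwa [h3, Complex.ofReal_re] at h2
  have hTf : T f = 0 := map_eq_zero_of_hilbertSchmidt hS hinv hrig hTk hc hμ hstar
    (sum_norm_sq_le_of_ae_le hTae) hf
  set g := markov hp hq f with hg
  -- Since T = W*WA, ⟨g, T f⟩ = ‖W g‖².
  have hWg : W g = 0 := by
    have h1 := hTin f g
    rw [hTf, inner_zero_right] at h1
    exact inner_self_eq_zero.1 h1.symm
  have h2 := hW g (pull hp f)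
  rw [hWg, inner_zero_right] at h2
  have h3 : Tendsto (fun i => ⟪koopman ν (t i) g, markov hp hq (mulInd μ (hS i) f)⟫_ℂ)
      (hyperfilter ℕ : Filter ℕ) (𝓝 0) := by
    have h4 := (Complex.continuous_conj.tendsto 0).comp h2
    rw [map_zero] at h4
    refine h4.congr fun i => ?_
    rw [Function.comp_apply, inner_conj_symm, inner_markov, cutShift_apply, inner_mulInd_left,
      mulInd_pull hp (hS i)]
  have h5 := h3.sub ((tendsto_inner_koopman_map_mulInd_sub hS hinv hrig hAk f g).mono_left hl)
  rw [sub_zero] at h5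
  have h6 : ⟪g, g⟫_ℂ = 0 := by
    refine eq_zero_of_tendsto_measureReal_mul hc hμ (h5.congr fun i => ?_)
    rw [← hg]
    ring
  exact inner_self_eq_zero.1 h6

include hp hq hpe hqe hinv hrig hc hμ hstar in
/-- The two factor maps are independent. -/
theorem measure_inter_preimage {A : Set X} {B : Set Y} (hA : MeasurableSet A)
    (hB : MeasurableSet B) : ρ (p ⁻¹' A ∩ q ⁻¹' B) = μ A * ν B := by
  -- The centred indicator is killed by the Markov operator, so 1_A is sent to the constant μ(A);
  -- pairing with 1_B computes ρ.
  have hf : ⟪oneL2 μ, mulInd μ hA (oneL2 μ) - (μ.real A : ℂ) • oneL2 μ⟫_ℂ = 0 := by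
    rw [inner_sub_right, inner_smul_right, inner_oneL2_self, mul_one, inner_mulInd_oneL2, sub_self]
  have h1 := markov_eq_zero hp hq hpe hqe hS hinv hrig hc hμ hstar hf
  rw [map_sub, map_smul, markov_oneL2, sub_eq_zero] at h1
  have h2 : ⟪mulInd ν hB (oneL2 ν), markov hp hq (mulInd μ hA (oneL2 μ))⟫_ℂ =
      ρ.real (p ⁻¹' A ∩ q ⁻¹' B) := by
    rw [inner_markov, ← mulInd_pull hq hB (hq.measurable hB), ← mulInd_pull hp hA
      (hp.measurable hA), pull_oneL2, pull_oneL2, inner_mulInd_left, mulInd_comm,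
      inner_mulInd_oneL2, Set.inter_comm]
  have h3 : ⟪mulInd ν hB (oneL2 ν), oneL2 ν⟫_ℂ = ν.real B := by
    rw [inner_mulInd_left, inner_mulInd_oneL2]
  rw [h1, inner_smul_right, h3] at h2
  have h4 : μ.real A * ν.real B = ρ.real (p ⁻¹' A ∩ q ⁻¹' B) := by exact_mod_cast h2
  rw [measureReal_def, measureReal_def, measureReal_def, ← ENNReal.toReal_mul] at h4
  exact ((ENNReal.toReal_eq_toReal_iff' (ENNReal.mul_ne_top (measure_ne_top _ _)
    (measure_ne_top _ _)) (measure_ne_top _ _)).1 h4).symm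

end Coupling

end FlowDisjointness

/-! ### Disjointness of the flows -/

theorem mainTheorem5
    {X : Type*} [MetricSpace X] [SecondCountableTopology X] [MeasurableSpace X] [BorelSpace X]
    [AddAction ℝ X] [MeasurableVAdd₂ ℝ X]
    (μ : Measure X) [IsProbabilityMeasure μ] [ErgodicVAdd ℝ X μ]
    {Y : Type*} [MeasurableSpace Y] [AddAction ℝ Y] [MeasurableVAdd₂ ℝ Y]
    (ν : Measure Y) [IsProbabilityMeasure ν] [ErgodicVAdd ℝ Y ν]
    (c : ℝ) (hc : 0 < c) (t : ℕ → ℝ)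
    (hrigid : FlowDisjointness.IsPartialRigiditySeq μ c t)
    (hstar : FlowDisjointness.ConditionStar ν t) :
    FlowDisjointness.AreDisjoint μ ν := by
  obtain ⟨S, hS, hμ, hdist, himage⟩ := hrigid
  have hinv : ∀ s : ℝ, Tendsto (fun i => μ (symmDiff ((fun x : X => s +ᵥ x) ⁻¹' S i) (S i)))
      atTop (𝓝 0) := by
    intro s
    -- The image under F^{-s} is the preimage under F^s.
    refine (himage (-s)).congr fun i => ?_
    congr 2
    ext x
    constructor
    · rintro ⟨y, hy, rfl⟩
      simpa using hy
    · intro hx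
      exact ⟨s +ᵥ x, hx, by simp⟩
  have hrig := FlowDisjointness.tendsto_mulInd_koopman_sub hS hdist
  intro ρ
  constructor
  · rintro ⟨hρinv, hfst, hsnd⟩
    have hp : MeasurePreserving Prod.fst ρ μ := ⟨measurable_fst, hfst⟩
    have hq : MeasurePreserving Prod.snd ρ ν := ⟨measurable_snd, hsnd⟩
    have : IsProbabilityMeasure ρ := ⟨by
      rw [← Set.preimage_univ (f := Prod.fst), hp.measure_preimage nullMeasurableSet_univ,
        measure_univ]⟩
    have : MeasurableConstVAdd ℝ (X × Y) := ⟨fun s =>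
      ((measurable_const_vadd s).comp measurable_fst).prodMk
        ((measurable_const_vadd s).comp measurable_snd)⟩
    refine (Measure.prod_eq fun A B hA hB => ?_).symm
    rw [Set.prod_eq]
    exact FlowDisjointness.measure_inter_preimage hp hq (fun _ _ => rfl) (fun _ _ => rfl) hS hinv
      hrig hc hμ hstar hA hB
  · rintro rfl
    refine ⟨⟨fun s E hE => ?_⟩, ?_, ?_⟩
    · exact ((measurePreserving_vadd s μ).prod (measurePreserving_vadd s ν)).measure_preimage
        hE.nullMeasurableSet
    · simp
    · simp
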